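/- Let $\mathcal B\subseteq\mathbb R^3$ be open, let $\boldsymbol o$ be a fixed point and $\boldsymbol r=\boldsymbol x-\boldsymbol o$. For every time $t$ of a set $T\subseteq\mathbb R$ let $\boldsymbol\zeta$ (a vector field) and $\boldsymbol\Sigma$ (a second-order tensor field, the hypermicrostress) be of class $C^1$ in $\boldsymbol x$ on $\mathcal B$, and let $\boldsymbol\xi$ (the vector-valued microstress) and $\pi,\gamma$ (the scalar internal and external microforce densities) be continuous in $\boldsymbol x$ on $\mathcal B$. A *part* $\mathcal P$ of $\mathcal B$ is a bounded open set with $\overline{\mathcal P}\subseteq\mathcal B$ whose boundary consists of smooth points, with outward unit normal $\boldsymbol n$; of an internal edge $\mathcal C$ (possibly empty), along which two smooth surfaces $\partial\mathcal P^\pm$ meet transversally, convexly or reentrantly, with limiting outward unit normals $\boldsymbol n^\pm$ and limiting outward unit tangent-normals $\boldsymbol\nu^\pm$ ($\boldsymbol\nu^\pm$ is tangent to $\partial\mathcal P^\pm$, orthogonal to $\mathcal C$, and points out of $\partial\mathcal P^\pm$); and of finitely many vertices, near which $\mathcal P$ is diffeomorphic to a polyhedral cone near its apex. On $\partial\mathcal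 P$ put $\boldsymbol P=\boldsymbol 1-\boldsymbol n\otimes\boldsymbol n$, and let $\mathrm{div}_{\mathcal S}\,\boldsymbol g=\mathrm{tr}\big((\mathrm{grad}\,\boldsymbol g)\boldsymbol P\big)$ be the surface divergence. The surface microtraction, the internal-edge microtraction and the surface-couple microtraction are $$\xi_{\mathcal S}=\boldsymbol\zeta\cdot\boldsymbol n-\mathrm{div}_{\mathcal S}(\boldsymbol P\boldsymbol\Sigma\boldsymbol n),\qquad \tau_{\mathcal C}=\boldsymbol\nu^+\cdot\boldsymbol\Sigma\boldsymbol n^++\boldsymbol\nu^-\cdot\boldsymbol\Sigma\boldsymbol n^-,\qquad \boldsymbol\varpi_{\mathcal S}=(\boldsymbol n\otimes\boldsymbol n)\boldsymbol\Sigma\boldsymbol n,$$ the last one being an assumption that enters only the balance of microtorques. Suppose that the partwise balance of microforces $$\int_{\mathcal P}(\pi+\gamma)\,\mathrm dv+\int_{\partial\mathcal P}\xi_{\mathcal S}\,\mathrm da+\int_{\mathcal C}\tau_{\mathcal C}\,\mathrm ds=0$$ holds for all parts $\mathcal P$ of $\mathcal B$ and all $t\in T$. Then $$\mathrm{div}\,\boldsymbol\zeta+\pi+\gamma=0\quad\text{in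 }\mathcal B,\ \text{for all }t\in T.$$ If, moreover, the partwise balance of microtorques $$\int_{\mathcal P}\big((\pi+\gamma)\boldsymbol r-\boldsymbol\xi\big)\,\mathrm dv+\int_{\partial\mathcal P}(\xi_{\mathcal S}\boldsymbol r+\boldsymbol\varpi_{\mathcal S})\,\mathrm da+\int_{\mathcal C}\tau_{\mathcal C}\boldsymbol r\,\mathrm ds=\boldsymbol 0$$ holds for all parts $\mathcal P$ of $\mathcal B$ and all $t\in T$, then, in $\mathcal B$ and for all $t\in T$, with $(\mathrm{div}\,\boldsymbol\Sigma)_i=\sum_j\partial_j\Sigma_{ij}$, $$\boldsymbol\zeta=\boldsymbol\xi-\mathrm{div}\,\boldsymbol\Sigma,$$ the field $\boldsymbol\xi-\mathrm{div}\,\boldsymbol\Sigma$ is differentiable in $\boldsymbol x$, and the field equation holds: $$\mathrm{div}(\boldsymbol\xi-\mathrm{div}\,\boldsymbol\Sigma)+\pi+\gamma=0.$$ -/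

import Mathlib

open MeasureTheory Filter Topology
open scoped ContDiff MeasureTheory InnerProductSpace

noncomputable section

namespace PhaseField

/-- Three-dimensional Euclidean point space, with its translation space. -/
abbrev E3 : Type := EuclideanSpace ℝ (Fin 3)

/-- Second-order tensors (`Lin`). -/
abbrev Tensor : Type := E3 →L[ℝ] E3

/-- The standard orthonormal basis. -/
def basisVec (i : Fin 3) : E3 := EuclideanSpace.single i (1 : ℝ)

/-- The trace of a tensor. -/
def tensorTrace (A : Tensor) : ℝ := ∑ i : Fin 3, ⟪basisVec i, A (basisVec i)⟫_ℝ

/-- Divergence of a vector field, `tr (grad g)`. -/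
def vecDiv (g : E3 → E3) (x : E3) : ℝ := tensorTrace (fderiv ℝ g x)

/-- (Row-wise) divergence of a tensor field, `(div S)_i = ∑_j ∂_j S_ij`. -/
def tensorDiv (S : E3 → Tensor) (x : E3) : E3 :=
  ∑ j : Fin 3, (fderiv ℝ S x (basisVec j)) (basisVec j)

/-- The tangential projection `1 - n ⊗ n`. -/
def tangentProj (n : E3) : Tensor :=
  ContinuousLinearMap.id ℝ E3 - (innerSL ℝ n).smulRight n

/-- Surface gradient `(grad g)(1 - n ⊗ n)` at `x` of a field `g` on a surface `S` with unit normal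
`n` at `x`.  The derivative is taken within `S`; its values on vectors tangent to `S`, which are the
only ones that enter, do not depend on an extension of `g` off `S`. -/
def surfGrad (S : Set E3) (n : E3) (g : E3 → E3) (x : E3) : Tensor :=
  (fderivWithin ℝ g S x).comp (tangentProj n)

/-- Surface divergence, the trace of the surface gradient. -/
def surfDiv (S : Set E3) (n : E3) (g : E3 → E3) (x : E3) : ℝ :=
  tensorTrace (surfGrad S n g x)

/-- The boundary of the region `P` is smooth at `x`, with outward unit normal `n`: near `x` the
region is `{φ < 0}` with `φ` smooth, `φ x = 0`, `∇φ x ≠ 0`. -/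
def IsOutwardNormal (P : Set E3) (x n : E3) : Prop :=
  ∃ φ : E3 → ℝ, ContDiffAt ℝ ∞ φ x ∧ φ x = 0 ∧ gradient φ x ≠ 0 ∧
    (∀ᶠ y in 𝓝 x, y ∈ P ↔ φ y < 0) ∧
    n = ‖gradient φ x‖⁻¹ • gradient φ x

/-- The boundary of the region `P` has an edge at `x`, where two smooth surfaces
`∂P⁺ ⊆ {φ⁺ = 0}` and `∂P⁻ ⊆ {φ⁻ = 0}` meet transversally; `n⁺, n⁻` are the limiting outward unit
normals and `ν⁺, ν⁻` the limiting outward unit tangent-normals of `∂P⁺`, `∂P⁻`.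
The edge may be convex or reentrant.  `ν⁺` is a unit vector tangent to `∂P⁺` and orthogonal to the
edge, i.e. orthogonal to `n⁺` and in the plane of `n⁺, n⁻`, and it points out of `∂P⁺`:
towards `φ⁻ > 0` at a convex edge, where `∂P⁺ ⊆ {φ⁻ ≤ 0}`, and towards `φ⁻ < 0` at a reentrant one,
where `∂P⁺ ⊆ {φ⁻ ≥ 0}`.  The same for `ν⁻`. -/
def IsEdgeFrame (P : Set E3) (x nP nM νP νM : E3) : Prop :=
  ∃ φP φM : E3 → ℝ, ContDiffAt ℝ ∞ φP x ∧ ContDiffAt ℝ ∞ φM x ∧ φP x = 0 ∧ φM x = 0 ∧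
    LinearIndependent ℝ ![gradient φP x, gradient φM x] ∧
    nP = ‖gradient φP x‖⁻¹ • gradient φP x ∧
    nM = ‖gradient φM x‖⁻¹ • gradient φM x ∧
    ‖νP‖ = 1 ∧ ⟪νP, nP⟫_ℝ = 0 ∧ νP ∈ Submodule.span ℝ {nP, nM} ∧
    ‖νM‖ = 1 ∧ ⟪νM, nM⟫_ℝ = 0 ∧ νM ∈ Submodule.span ℝ {nP, nM} ∧
    (((∀ᶠ y in 𝓝 x, y ∈ P ↔ φP y < 0 ∧ φM y < 0) ∧ 0 < ⟪νP, nM⟫_ℝ ∧ 0 < ⟪νM, nP⟫_ℝ) ∨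
     ((∀ᶠ y in 𝓝 x, y ∈ P ↔ φP y < 0 ∨ φM y < 0) ∧ ⟪νP, nM⟫_ℝ < 0 ∧ ⟪νM, nP⟫_ℝ < 0))

/-- Open polyhedral cones with apex `0`: finite unions of finite intersections of open
half-spaces. -/
def IsOpenPolyhedralCone (K : Set E3) : Prop :=
  ∃ F : Finset (Finset E3), K = {y | ∃ s ∈ F, ∀ a ∈ s, ⟪a, y⟫_ℝ < 0}

/-- The region `P` looks near `x` like a polyhedral cone near its apex, up to a local
diffeomorphism. -/
def IsVertex (P : Set E3) (x : E3) : Prop :=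
  ∃ Φ : E3 → E3, ContDiffAt ℝ ∞ Φ x ∧ Φ x = 0 ∧ (fderiv ℝ Φ x).IsInvertible ∧
    ∃ K : Set E3, IsOpenPolyhedralCone K ∧ ∀ᶠ y in 𝓝 x, y ∈ P ↔ Φ y ∈ K

/-- A part `P` of the body `B`: a bounded open region with closure in `B` and piecewise smooth
boundary.  The boundary consists of its smooth points (`face`), of the internal edge `C` (`edge`,
which may have several components or be empty) and of finitely many vertices at which smooth arcs
of `C` meet.  The unit normals and tangent-normals are determined by `region`, up to exchanging
`+` and `-` at an edge point. -/
structure Part (B : Set E3) where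
  region : Set E3
  isOpen_region : IsOpen region
  isBounded_region : Bornology.IsBounded region
  closure_subset : closure region ⊆ B
  face : Set E3
  edge : Set E3
  vertices : Set E3
  finite_vertices : vertices.Finite
  frontier_eq : frontier region = face ∪ edge ∪ vertices
  normal : E3 → E3
  isOutwardNormal : ∀ x ∈ face, IsOutwardNormal region x (normal x)
  normalPlus : E3 → E3
  normalMinus : E3 → E3
  tangentNormalPlus : E3 → E3
  tangentNormalMinus : E3 → E3
  isEdgeFrame : ∀ x ∈ edge, IsEdgeFrame region x (normalPlus x) (normalMinus x)
    (tangentNormalPlus x) (tangentNormalMinus x)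
  isVertex : ∀ x ∈ vertices, IsVertex region x

variable {B : Set E3}

/-- The surface microtraction `ξ_S = ζ · n - div_S ((1 - n ⊗ n) S n)` on `∂P`, for the
microstress-like field `ζ` and the hypermicrostress `S`. -/
def surfaceMicrotraction (P : Part B) (ζ : E3 → E3) (S : E3 → Tensor) (x : E3) : ℝ :=
  ⟪ζ x, P.normal x⟫_ℝ -
    surfDiv P.face (P.normal x) (fun y => tangentProj (P.normal y) (S y (P.normal y))) x

/-- The internal-edge microtraction `τ_C = ν⁺ · S n⁺ + ν⁻ · S n⁻`. -/
def internalEdgeMicrotraction (P : Part B) (S : E3 → Tensor) (x : E3) : ℝ :=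
  ⟪P.tangentNormalPlus x, S x (P.normalPlus x)⟫_ℝ +
    ⟪P.tangentNormalMinus x, S x (P.normalMinus x)⟫_ℝ

/-- The surface-couple microtraction `ϖ_S = (n ⊗ n) S n = (n · S n) n`. -/
def surfaceCoupleMicrotraction (P : Part B) (S : E3 → Tensor) (x : E3) : E3 :=
  ⟪P.normal x, S x (P.normal x)⟫_ℝ • P.normal x

/-- Partwise balance of microforces on `P`.  Here `μHE[2]` is surface area and `μHE[1]` is
arc length. -/
def MicroforceBalance (P : Part B) (ζ : E3 → E3) (S : E3 → Tensor) (π γ : E3 → ℝ) : Prop :=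
  (∫ x in P.region, (π x + γ x)) +
    (∫ x in P.face, surfaceMicrotraction P ζ S x ∂μHE[2]) +
    (∫ x in P.edge, internalEdgeMicrotraction P S x ∂μHE[1]) = 0

/-- Partwise balance of microtorques on `P` about the point `o`, with `r = x - o`. -/
def MicrotorqueBalance (P : Part B) (o : E3) (ζ ξ : E3 → E3) (S : E3 → Tensor)
    (π γ : E3 → ℝ) : Prop :=
  (∫ x in P.region, ((π x + γ x) • (x - o) - ξ x)) +
    (∫ x in P.face, (surfaceMicrotraction P ζ S x • (x - o) +
      surfaceCoupleMicrotraction P S x) ∂μHE[2]) +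
    (∫ x in P.edge, internalEdgeMicrotraction P S x • (x - o) ∂μHE[1]) = 0

end PhaseField

end

/-! It is enough to test the balances on coordinate cubes, which are parts of the body. On a cube
the tractions are explicit. A face has constant normal `n = s e_i` with `s = ±1`, so `ξ_S = s (ζ_i -
∑_{j ≠ i} ∂_j S_ji)`. At an edge each tangent-normal is the normal of the other face, so with
normals `s e_i` and `s' e_j` one gets `τ_C = s s' (S_ij + S_ji)`.

Let `f` be affine with gradient `a`. Integrating `(∂_j S_ji) f` by parts over a face, along the free
coordinate `j`, produces edge integrals that cancel those of `τ_C f`, and leaves the tangential term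
`a · P S n`. Together with the divergence theorem for `f ζ` this gives `traction_power`: `∫ ξ_S f da
+ ∫ τ_C f ds = ∫ (f div ζ + a · ζ) dv + ∫ a · P S n da`.

For `f = 1` the force balance says that `div ζ + π + γ` has integral zero over every closed cube in
`B`; being continuous, it vanishes (`vecDiv_add_eq_zero`). For `f = (x - o)_m` the couple
microtraction supplies the missing normal part of `S n` (`surfaceCouple_component`), so the surface
term becomes the flux of the `m`-th row of `S`, which is `∫ (div S)_m`. The terms containing `x - o`
drop out by the first field equation, and `∫ (ζ - ξ + div S) = 0` on all cubes gives
`microstress_eq`. Finally `ξ - div S` equals the `C^1` field `ζ` on the open set `B`, which gives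
its differentiability and the last equation. -/

noncomputable section

namespace PhaseField

/-! ### Cells of a cube and their measures. -/

/-- The measure carried by one coordinate of a cell of the cube: Lebesgue measure on an open
interval for a free coordinate, a unit mass at an end point for a fixed one. -/
def coordMeasure (m δ : ℝ) (s : SignType) : Measure ℝ :=
  if s = 0 then volume.restrict (Set.Ioo (m - δ) (m + δ)) else Measure.dirac (m + s * δ)

instance (m δ : ℝ) (s : SignType) : IsFiniteMeasure (coordMeasure m δ s) := by
  unfold coordMeasure; split_ifs <;> infer_instance

/-- The relatively open cell of the cube with centre `c` and half side `δ` in which the `i`-th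
coordinate is free if `σ i = 0` and fixed to `c i + σ i * δ` otherwise. -/
def cell (c : E3) (δ : ℝ) (σ : Fin 3 → SignType) : Set E3 :=
  {x | ∀ i, if σ i = 0 then |x i - c i| < δ else x i = c i + σ i * δ}

/-- The closed cube with centre `c` and half side `δ`. -/
def closedCube (c : E3) (δ : ℝ) : Set E3 := {x | ∀ i, |x i - c i| ≤ δ}

/-- The product measure of a cell, on coordinate tuples. -/
def cellMeasure (c : E3) (δ : ℝ) (σ : Fin 3 → SignType) : Measure (Fin 3 → ℝ) :=
  Measure.pi fun i => coordMeasure (c i) δ (σ i)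

instance (c : E3) (δ : ℝ) (σ : Fin 3 → SignType) : IsFiniteMeasure (cellMeasure c δ σ) := by
  unfold cellMeasure; infer_instance

/-- The integral of a field over a cell, in coordinates. -/
def cellIntegral {E : Type*} [NormedAddCommGroup E] [NormedSpace ℝ E] (c : E3) (δ : ℝ)
    (σ : Fin 3 → SignType) (h : E3 → E) : E :=
  ∫ y, h (WithLp.toLp 2 y) ∂cellMeasure c δ σ

theorem measurableSet_cell (c : E3) (δ : ℝ) (σ : Fin 3 → SignType) :
    MeasurableSet (cell c δ σ) := by
  unfold cell
  rw [Set.ofPred_forall]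
  refine MeasurableSet.iInter fun i => ?_
  have hm : Measurable fun x : E3 => x i := by fun_prop
  split_ifs
  · exact measurableSet_lt (by fun_prop) measurable_const
  · exact measurableSet_eq_fun hm measurable_const

theorem abs_sign_mul_le {δ : ℝ} (hδ : 0 < δ) (s : SignType) : |(s : ℝ) * δ| ≤ δ := by
  cases s <;> simp [abs_of_pos hδ, hδ.le]

theorem cell_subset_closedCube {c : E3} {δ : ℝ} (hδ : 0 < δ) (σ : Fin 3 → SignType) :
    cell c δ σ ⊆ closedCube c δ := by
  intro x hx i
  have := hx i
  split_ifs at this with h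
  · exact this.le
  · rw [this, add_sub_cancel_left]; exact abs_sign_mul_le hδ _

theorem isCompact_closedCube (c : E3) (δ : ℝ) : IsCompact (closedCube c δ) := by
  have : closedCube c δ = (EuclideanSpace.equiv (Fin 3) ℝ).toHomeomorph ⁻¹'
      (Set.univ.pi fun i => Set.Icc (c i - δ) (c i + δ)) := by
    ext x
    simp only [closedCube, Set.mem_ofPred_eq, Set.mem_preimage, Set.mem_pi, Set.mem_univ,
      forall_true_left, Set.mem_Icc, abs_le]
    refine forall_congr' fun i => ?_
    change _ ↔ c i - δ ≤ x i ∧ x i ≤ c i + δ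
    constructor <;> intro h <;> constructor <;> linarith [h.1, h.2]
  rw [this, Homeomorph.isCompact_preimage]
  exact isCompact_univ_pi fun i => isCompact_Icc

theorem ae_coordMeasure {m δ : ℝ} (hδ : 0 < δ) (s : SignType) :
    ∀ᵐ t ∂coordMeasure m δ s, |t - m| ≤ δ := by
  unfold coordMeasure
  split_ifs with h
  · refine (ae_restrict_iff' measurableSet_Ioo).2 (ae_of_all _ fun t ht => ?_)
    rw [abs_le]; constructor <;> linarith [ht.1, ht.2]
  · rw [ae_dirac_eq]
    simpa using abs_sign_mul_le hδ s

theorem ae_cellMeasure {c : E3} {δ : ℝ} (hδ : 0 < δ) (σ : Fin 3 → SignType) :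
    ∀ᵐ y ∂cellMeasure c δ σ, WithLp.toLp 2 y ∈ closedCube c δ := by
  refine ae_all_iff.2 fun i => ?_
  exact (Measure.tendsto_eval_ae_ae (μ := fun i => coordMeasure (c i) δ (σ i)) (i := i)).eventually
    (ae_coordMeasure hδ (σ i))

/-- The measure is finite and concentrated on the compact closed cube, so continuity there suffices
for every cell, whatever its dimension. -/
theorem integrable_cellMeasure {E : Type*} [NormedAddCommGroup E]
    {c : E3} {δ : ℝ} (hδ : 0 < δ) (σ : Fin 3 → SignType) {h : E3 → E}
    (hh : ContinuousOn h (closedCube c δ)) :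
    Integrable (fun y => h (WithLp.toLp 2 y)) (cellMeasure c δ σ) := by
  have hK : IsCompact ((WithLp.toLp 2 : (Fin 3 → ℝ) → E3) ⁻¹' closedCube c δ) :=
    (EuclideanSpace.equiv (Fin 3) ℝ).symm.toHomeomorph.isCompact_preimage.2
      (isCompact_closedCube c δ)
  have := ContinuousOn.integrableOn_compact (μ := cellMeasure c δ σ) hK
    (hh.comp (PiLp.continuous_toLp 2 _).continuousOn (Set.mapsTo_preimage _ _))
  have hae : ∀ᵐ y ∂cellMeasure c δ σ,
      y ∈ (WithLp.toLp 2 : (Fin 3 → ℝ) → E3) ⁻¹' closedCube c δ := ae_cellMeasure hδ σ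
  rwa [IntegrableOn, Measure.restrict_eq_self_of_ae_mem hae] at this

/-- Parametrization of the affine span of a cell by its free coordinates. -/
def cellParam (c : E3) (δ : ℝ) (σ : Fin 3 → SignType) (y : EuclideanSpace ℝ {i // σ i = 0}) : E3 :=
  WithLp.toLp 2 fun i => if h : σ i = 0 then y ⟨i, h⟩ else c i + σ i * δ

theorem isometry_cellParam (c : E3) (δ : ℝ) (σ : Fin 3 → SignType) :
    Isometry (cellParam c δ σ) := by
  refine Isometry.of_dist_eq fun y z => ?_
  rw [EuclideanSpace.dist_eq, EuclideanSpace.dist_eq]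
  congr 1
  rw [← Fintype.sum_subtype_add_sum_subtype (fun i => σ i = 0)]
  rw [Finset.sum_congr rfl (g := fun i => dist (y i) (z i) ^ 2), add_eq_left]
  · refine Finset.sum_eq_zero fun i _ => ?_
    simp [cellParam, i.2]
  · intro i _
    simp [cellParam, i.2]

theorem dirac_pi {ι : Type*} [Fintype ι] (a : ι → ℝ) :
    Measure.pi (fun i => Measure.dirac (a i)) = Measure.dirac a := by
  refine Measure.pi_eq fun s hs => ?_
  rw [Measure.dirac_apply' _ (MeasurableSet.univ_pi hs)]
  simp_rw [Measure.dirac_apply' _ (hs _)]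
  by_cases h : ∀ i, a i ∈ s i
  · simp [Set.indicator, h]
  · rw [Set.indicator_of_notMem (by simpa using h)]
    push Not at h
    obtain ⟨i, hi⟩ := h
    exact (Finset.prod_eq_zero (Finset.mem_univ i) (by simp [hi])).symm

/-- Turns area and arc length into product measures. The isometry `cellParam` carries the Hausdorff
measure of its domain to that of its range, which contains the cell; on the domain this measure is
Lebesgue measure. -/
theorem restrict_cell_eq_map (c : E3) (δ : ℝ) (σ : Fin 3 → SignType) :
    (μHE[Fintype.card {i // σ i = 0}] : Measure E3).restrict (cell c δ σ) =
      (cellMeasure c δ σ).map (WithLp.toLp 2) := by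
  have hiso := isometry_cellParam c δ σ
  have hmeas : Measurable (cellParam c δ σ) := hiso.continuous.measurable
  have hsub : cell c δ σ ⊆ Set.range (cellParam c δ σ) := by
    intro x hx
    refine ⟨WithLp.toLp 2 fun i => x i, ?_⟩
    ext i
    have := hx i
    by_cases h : σ i = 0
    · simp [cellParam, h]
    · simp only [h, if_false] at this
      simp [cellParam, h, this]
  have hvol : (μHE[Fintype.card {i // σ i = 0}] : Measure (EuclideanSpace ℝ {i // σ i = 0})) =
      volume := by
    rw [← InnerProductSpace.euclideanHausdorffMeasure_eq_volume, finrank_euclideanSpace]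
  have hpre : (WithLp.toLp 2 : ({i // σ i = 0} → ℝ) → _) ⁻¹' (cellParam c δ σ ⁻¹' cell c δ σ) =
      Set.univ.pi fun i : {i // σ i = 0} => Set.Ioo (c i - δ) (c i + δ) := by
    ext y
    simp only [Set.mem_preimage, cell, Set.mem_ofPred_eq, cellParam, Set.mem_pi, Set.mem_univ,
      forall_true_left, Set.mem_Ioo]
    constructor
    · rintro h ⟨i, hi⟩
      have := h i
      simp only [hi, if_true, dif_pos, abs_lt] at this
      constructor <;> linarith [this.1, this.2]
    · intro h i
      split_ifs with hi
      · have := h ⟨i, hi⟩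
        simp only [abs_lt] at this ⊢
        constructor <;> linarith [this.1, this.2]
      · rfl
  rw [← Set.inter_eq_left.2 hsub, ← Measure.restrict_restrict (measurableSet_cell c δ σ),
    ← hiso.map_euclideanHausdorffMeasure, hvol,
    Measure.restrict_map hmeas (measurableSet_cell c δ σ),
    ← (PiLp.volume_preserving_toLp {i // σ i = 0}).map_eq,
    Measure.restrict_map (by fun_prop) (hmeas (measurableSet_cell c δ σ)), hpre, volume_pi,
    Measure.restrict_pi_pi, cellMeasure,
    ← (measurePreserving_piEquivPiSubtypeProd (fun i => coordMeasure (c i) δ (σ i))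
      (fun i => σ i = 0)).symm.map_eq]
  have h1 : (fun i : {i // σ i = 0} => coordMeasure (c i) δ (σ i)) =
      fun i : {i // σ i = 0} => volume.restrict (Set.Ioo (c i - δ) (c i + δ)) := by
    funext i; simp [coordMeasure, i.2]
  have h2 : (fun i : {i // ¬ σ i = 0} => coordMeasure (c i) δ (σ i)) =
      fun i : {i // ¬ σ i = 0} => Measure.dirac (c i + σ i * δ) := by
    funext i; simp [coordMeasure, i.2]
  -- The fixed coordinates together carry one unit mass, so both sides are images of Lebesgue
  -- measure on the free coordinates.
  rw [h1, h2, dirac_pi, Measure.prod_dirac, Measure.map_map hmeas (by fun_prop),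
    Measure.map_map (by fun_prop) (by fun_prop), Measure.map_map (by fun_prop) (by fun_prop)]
  rfl

theorem setIntegral_cell {E : Type*} [NormedAddCommGroup E] [NormedSpace ℝ E]
    (c : E3) (δ : ℝ) (σ : Fin 3 → SignType) {d : ℕ}
    (hd : Fintype.card {i // σ i = 0} = d) (h : E3 → E) :
    ∫ x in cell c δ σ, h x ∂μHE[d] = cellIntegral c δ σ h := by
  rw [← hd, restrict_cell_eq_map, cellIntegral]
  exact (MeasurableEquiv.toLp 2 (Fin 3 → ℝ)).measurableEmbedding.integral_map h

theorem integrableOn_cell {E : Type*} [NormedAddCommGroup E]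
    {c : E3} {δ : ℝ} (hδ : 0 < δ) (σ : Fin 3 → SignType) {d : ℕ}
    (hd : Fintype.card {i // σ i = 0} = d) {h : E3 → E} (hh : ContinuousOn h (closedCube c δ)) :
    IntegrableOn h (cell c δ σ) μHE[d] := by
  rw [IntegrableOn, ← hd, restrict_cell_eq_map]
  exact ((MeasurableEquiv.toLp 2 (Fin 3 → ℝ)).measurableEmbedding.integrable_map_iff).2
    (integrable_cellMeasure hδ σ hh)

/-! ### Fubini and the fundamental theorem of calculus on cells. -/

theorem integrable_iterated {E : Type*} [NormedAddCommGroup E] [NormedSpace ℝ E]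
    {c : E3} {δ : ℝ} (hδ : 0 < δ) (σ : Fin 3 → SignType) (j : Fin 3)
    {h : E3 → E} (hh : ContinuousOn h (closedCube c δ)) :
    Integrable (fun p : ℝ × (Fin 2 → ℝ) => h (WithLp.toLp 2 (j.insertNth p.1 p.2)))
      ((coordMeasure (c j) δ (σ j)).prod
        (Measure.pi fun i => coordMeasure (c (j.succAbove i)) δ (σ (j.succAbove i)))) := by
  have hp := measurePreserving_piFinSuccAbove (fun i => coordMeasure (c i) δ (σ i)) j
  have hint := integrable_cellMeasure hδ σ hh
  have he := (MeasurableEquiv.piFinSuccAbove (fun _ : Fin 3 => ℝ) j).symm.measurableEmbedding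
  rw [cellMeasure, ← hp.symm.map_eq, he.integrable_map_iff] at hint
  exact hint

/-- Since `coordMeasure` covers free and fixed coordinates alike, one formula serves a cell and its
two ends in direction `j`. -/
theorem cellIntegral_eq_iterated {E : Type*} [NormedAddCommGroup E] [NormedSpace ℝ E]
    {c : E3} {δ : ℝ} (hδ : 0 < δ) (σ : Fin 3 → SignType) (j : Fin 3)
    {h : E3 → E} (hh : ContinuousOn h (closedCube c δ)) :
    cellIntegral c δ σ h =
      ∫ y, ∫ t, h (WithLp.toLp 2 (j.insertNth t y)) ∂coordMeasure (c j) δ (σ j)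
        ∂Measure.pi fun i => coordMeasure (c (j.succAbove i)) δ (σ (j.succAbove i)) := by
  have hp := measurePreserving_piFinSuccAbove (fun i => coordMeasure (c i) δ (σ i)) j
  have he := (MeasurableEquiv.piFinSuccAbove (fun _ : Fin 3 => ℝ) j).symm.measurableEmbedding
  rw [cellIntegral, cellMeasure, ← hp.symm.map_eq, he.integral_map,
    ← integral_prod_symm _ (integrable_iterated hδ σ j hh)]
  rfl

theorem coordMeasure_update_self (c : E3) (δ : ℝ) (σ : Fin 3 → SignType) (j : Fin 3)
    {s : SignType} (hs : s ≠ 0) :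
    coordMeasure (c j) δ (Function.update σ j s j) = Measure.dirac (c j + s * δ) := by
  simp [coordMeasure, hs]

theorem coordMeasure_update_succAbove (c : E3) (δ : ℝ) (σ : Fin 3 → SignType) (j : Fin 3)
    (s : SignType) :
    (fun i => coordMeasure (c (j.succAbove i)) δ (Function.update σ j s (j.succAbove i))) =
      fun i => coordMeasure (c (j.succAbove i)) δ (σ (j.succAbove i)) := by
  funext i
  rw [Function.update_of_ne (Fin.succAbove_ne j i)]

theorem ae_insertNth_mem_closedCube {c : E3} {δ : ℝ} (hδ : 0 < δ) (σ : Fin 3 → SignType)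
    (j : Fin 3) :
    ∀ᵐ y ∂Measure.pi fun i => coordMeasure (c (j.succAbove i)) δ (σ (j.succAbove i)),
      ∀ t, |t - c j| ≤ δ → (WithLp.toLp 2 (j.insertNth t y) : E3) ∈ closedCube c δ := by
  have h : ∀ᵐ y ∂Measure.pi fun i => coordMeasure (c (j.succAbove i)) δ (σ (j.succAbove i)),
      ∀ i, |y i - c (j.succAbove i)| ≤ δ := by
    refine ae_all_iff.2 fun i => ?_
    exact (Measure.tendsto_eval_ae_ae
      (μ := fun i => coordMeasure (c (j.succAbove i)) δ (σ (j.succAbove i))) (i := i)).eventually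
      (ae_coordMeasure hδ _)
  filter_upwards [h] with y hy t ht
  refine (Fin.forall_iff_succAbove j).2 ⟨?_, fun i => ?_⟩
  · simpa using ht
  · simpa using hy i

theorem hasDerivAt_toLp_insertNth (j : Fin 3) (y : Fin 2 → ℝ) (t : ℝ) :
    HasDerivAt (fun t : ℝ => (WithLp.toLp 2 (j.insertNth t y : Fin 3 → ℝ) : E3))
      (basisVec j) t := by
  have h : (fun t : ℝ => (WithLp.toLp 2 (j.insertNth t y : Fin 3 → ℝ) : E3)) =
      fun t => WithLp.toLp 2 (j.insertNth 0 y : Fin 3 → ℝ) + t • basisVec j := by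
    funext t
    ext i
    induction i using Fin.succAboveCases j with
    | x => simp [basisVec]
    | p i => simp [basisVec, Fin.succAbove_ne]
  rw [h]
  simpa using ((hasDerivAt_id t).smul_const (basisVec j)).const_add
    (WithLp.toLp 2 (j.insertNth 0 y : Fin 3 → ℝ))

/-- The fundamental theorem of calculus along a free coordinate of a cell. -/
theorem cellIntegral_fderiv {c : E3} {δ : ℝ} (hδ : 0 < δ) {σ : Fin 3 → SignType} {j : Fin 3}
    (hj : σ j = 0) {h : E3 → ℝ} (hd : ∀ x ∈ closedCube c δ, DifferentiableAt ℝ h x)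
    (hc : ContinuousOn (fun x => fderiv ℝ h x (basisVec j)) (closedCube c δ)) :
    cellIntegral c δ σ (fun x => fderiv ℝ h x (basisVec j)) =
      cellIntegral c δ (Function.update σ j 1) h -
        cellIntegral c δ (Function.update σ j (-1)) h := by
  have hh : ContinuousOn h (closedCube c δ) := fun x hx =>
    (hd x hx).continuousAt.continuousWithinAt
  -- Fixing coordinate `j` turns the inner integral into an evaluation at an end point and leaves
  -- the outer measure unchanged.
  have hend : ∀ s : SignType, s ≠ 0 →
      cellIntegral c δ (Function.update σ j s) h =
        ∫ y, h (WithLp.toLp 2 (j.insertNth (c j + s * δ) y))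
          ∂Measure.pi fun i => coordMeasure (c (j.succAbove i)) δ (σ (j.succAbove i)) := by
    intro s hs
    rw [cellIntegral_eq_iterated hδ _ j hh, coordMeasure_update_succAbove,
      coordMeasure_update_self _ _ _ _ hs]
    simp_rw [integral_dirac]
  have hint : ∀ s : SignType, s ≠ 0 →
      Integrable (fun y => h (WithLp.toLp 2 (j.insertNth (c j + s * δ) y)))
          (Measure.pi fun i => coordMeasure (c (j.succAbove i)) δ (σ (j.succAbove i))) := by
    intro s hs
    have := (integrable_iterated hδ (Function.update σ j s) j hh).integral_prod_right
    rw [coordMeasure_update_succAbove, coordMeasure_update_self _ _ _ _ hs] at this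
    simpa only [integral_dirac] using this
  rw [cellIntegral_eq_iterated hδ _ j hc, hend 1 (by decide), hend (-1) (by decide),
    ← integral_sub (hint 1 (by decide)) (hint (-1) (by decide))]
  refine integral_congr_ae ?_
  filter_upwards [ae_insertNth_mem_closedCube hδ σ j] with y hy
  have hle : c j - δ ≤ c j + δ := by linarith
  have hmem : ∀ t ∈ Set.uIcc (c j - δ) (c j + δ), |t - c j| ≤ δ := by
    intro t ht
    rw [Set.uIcc_of_le hle] at ht
    rw [abs_le]; constructor <;> linarith [ht.1, ht.2]
  have hderiv : ∀ t ∈ Set.uIcc (c j - δ) (c j + δ),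
      HasDerivAt (fun t => h (WithLp.toLp 2 (j.insertNth t y)))
        (fderiv ℝ h (WithLp.toLp 2 (j.insertNth t y)) (basisVec j)) t := fun t ht =>
    (hd _ (hy t (hmem t ht))).hasFDerivAt.comp_hasDerivAt t (hasDerivAt_toLp_insertNth j y t)
  have hcont : ContinuousOn
      (fun t => fderiv ℝ h (WithLp.toLp 2 (j.insertNth t y)) (basisVec j))
      (Set.uIcc (c j - δ) (c j + δ)) :=
    hc.comp (fun t _ => (hasDerivAt_toLp_insertNth j y t).continuousAt.continuousWithinAt)
      fun t ht => hy t (hmem t ht)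
  have := intervalIntegral.integral_eq_sub_of_hasDerivAt hderiv hcont.intervalIntegrable
  rw [intervalIntegral.integral_of_le hle, integral_Ioc_eq_integral_Ioo] at this
  simpa [coordMeasure, hj, sub_eq_add_neg] using this

/-! ### Linearity of cell integrals. -/

section
variable {E : Type*} [NormedAddCommGroup E] [NormedSpace ℝ E]

theorem cellIntegral_congr {c : E3} {δ : ℝ} (hδ : 0 < δ) (σ : Fin 3 → SignType) {g h : E3 → E}
    (hgh : Set.EqOn g h (closedCube c δ)) : cellIntegral c δ σ g = cellIntegral c δ σ h := by
  refine integral_congr_ae ?_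
  filter_upwards [ae_cellMeasure hδ σ] with y hy using hgh hy

theorem cellIntegral_add {c : E3} {δ : ℝ} (hδ : 0 < δ) (σ : Fin 3 → SignType) {g h : E3 → E}
    (hg : ContinuousOn g (closedCube c δ)) (hh : ContinuousOn h (closedCube c δ)) :
    cellIntegral c δ σ (fun x => g x + h x) = cellIntegral c δ σ g + cellIntegral c δ σ h :=
  integral_add (integrable_cellMeasure hδ σ hg) (integrable_cellMeasure hδ σ hh)

theorem cellIntegral_sub {c : E3} {δ : ℝ} (hδ : 0 < δ) (σ : Fin 3 → SignType) {g h : E3 → E}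
    (hg : ContinuousOn g (closedCube c δ)) (hh : ContinuousOn h (closedCube c δ)) :
    cellIntegral c δ σ (fun x => g x - h x) = cellIntegral c δ σ g - cellIntegral c δ σ h :=
  integral_sub (integrable_cellMeasure hδ σ hg) (integrable_cellMeasure hδ σ hh)

theorem cellIntegral_sum {ι : Type*} (s : Finset ι) {c : E3} {δ : ℝ} (hδ : 0 < δ)
    (σ : Fin 3 → SignType) {g : ι → E3 → E} (hg : ∀ i ∈ s, ContinuousOn (g i) (closedCube c δ)) :
    cellIntegral c δ σ (fun x => ∑ i ∈ s, g i x) = ∑ i ∈ s, cellIntegral c δ σ (g i) :=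
  integral_finsetSum _ fun i hi => integrable_cellMeasure hδ σ (hg i hi)

theorem cellIntegral_const_mul (c : E3) (δ : ℝ) (σ : Fin 3 → SignType) (r : ℝ) (h : E3 → ℝ) :
    cellIntegral c δ σ (fun x => r * h x) = r * cellIntegral c δ σ h :=
  integral_const_mul _ _

theorem inner_cellIntegral {c : E3} {δ : ℝ} (hδ : 0 < δ) (σ : Fin 3 → SignType) (v : E3)
    {h : E3 → E3} (hh : ContinuousOn h (closedCube c δ)) :
    ⟪v, cellIntegral c δ σ h⟫_ℝ = cellIntegral c δ σ (fun x => ⟪v, h x⟫_ℝ) :=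
  (integral_inner (integrable_cellMeasure hδ σ hh) v).symm

end

/-! ### Localization on small cubes. -/

theorem closedCube_subset_ball (c : E3) {δ : ℝ} (hδ : 0 < δ) :
    closedCube c δ ⊆ Metric.ball c (2 * δ) := by
  intro y hy
  rw [Metric.mem_ball, EuclideanSpace.dist_eq, Real.sqrt_lt' (by positivity), Fin.sum_univ_three]
  have h : ∀ i, dist (y i) (c i) ^ 2 ≤ δ ^ 2 := fun i =>
    pow_le_pow_left₀ dist_nonneg (hy i) 2
  -- The squared distance is at most `3 δ²`, which is below `(2 δ)²`.
  nlinarith [h 0, h 1, h 2]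

theorem cellMeasure_zero_univ_ne_zero (c : E3) {δ : ℝ} (hδ : 0 < δ) :
    cellMeasure c δ 0 Set.univ ≠ 0 := by
  rw [cellMeasure, Measure.pi_univ]
  refine Finset.prod_ne_zero_iff.2 fun i _ => ?_
  simp [coordMeasure, hδ]

/-- Otherwise `q > q x / 2 > 0` on a small cube of positive measure, and its integral could not
vanish. -/
theorem nonpos_of_cellIntegral_eq_zero {B : Set E3} (hB : IsOpen B) {q : E3 → ℝ}
    (hq : ContinuousOn q B) {x : E3} (hx : x ∈ B)
    (h0 : ∀ δ > 0, closedCube x δ ⊆ B → cellIntegral x δ 0 q = 0) : q x ≤ 0 := by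
  by_contra! hpos
  have hev : ∀ᶠ y in 𝓝 x, y ∈ B ∧ q x / 2 < q y :=
    (hB.eventually_mem hx).and
      ((hq.continuousAt (hB.mem_nhds hx)).eventually_const_lt (by linarith))
  obtain ⟨ε, hε, hball⟩ := Metric.eventually_nhds_iff_ball.1 hev
  have hδ : 0 < ε / 2 := by positivity
  have hsub : ∀ y ∈ closedCube x (ε / 2), y ∈ B ∧ q x / 2 < q y := fun y hy =>
    hball y (by simpa [mul_div_cancel₀] using closedCube_subset_ball x hδ hy)
  have hint := integrable_cellMeasure hδ 0 (hq.mono fun y hy => (hsub y hy).1)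
  have hle : ∫ _, q x / 2 ∂cellMeasure x (ε / 2) 0 ≤ cellIntegral x (ε / 2) 0 q := by
    refine integral_mono_ae (integrable_const _) hint ?_
    filter_upwards [ae_cellMeasure hδ 0] with y hy using (hsub _ hy).2.le
  rw [h0 _ hδ fun y hy => (hsub y hy).1, integral_const, smul_eq_mul] at hle
  have : 0 < (cellMeasure x (ε / 2) 0).real Set.univ :=
    ENNReal.toReal_pos (cellMeasure_zero_univ_ne_zero x hδ) (measure_ne_top _ _)
  nlinarith [mul_pos this hpos]

/-- A continuous function whose integral vanishes over all small cubes around a point vanishes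
there. -/
theorem eq_zero_of_cellIntegral_eq_zero {B : Set E3} (hB : IsOpen B) {q : E3 → ℝ}
    (hq : ContinuousOn q B) {x : E3} (hx : x ∈ B)
    (h0 : ∀ δ > 0, closedCube x δ ⊆ B → cellIntegral x δ 0 q = 0) : q x = 0 := by
  refine le_antisymm (nonpos_of_cellIntegral_eq_zero hB hq hx h0) ?_
  have := nonpos_of_cellIntegral_eq_zero (q := fun y => -q y) hB hq.neg hx fun δ hδ hs => by
    have h := cellIntegral_const_mul x δ 0 (-1) q
    simpa [h0 δ hδ hs] using h
  simpa using this

/-! ### Stratification of the closed cube by its cells. -/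

/-- The index of the cell of the closed cube that contains `x`. -/
def signature (c : E3) (δ : ℝ) (x : E3) : Fin 3 → SignType :=
  fun i => if |x i - c i| < δ then 0 else SignType.sign (x i - c i)

/-- The cells of codimension `k`. -/
def cellIndices (k : ℕ) : Finset (Fin 3 → SignType) :=
  Finset.univ.filter fun σ => (Finset.univ.filter fun i => σ i ≠ 0).card = k

/-- The union of the cells of codimension `k`. -/
def skeleton (c : E3) (δ : ℝ) (k : ℕ) : Set E3 := ⋃ σ ∈ cellIndices k, cell c δ σ

/-- The signed coordinate vectors of a cell index, added up. -/
def cellNormal (σ : Fin 3 → SignType) : E3 := ∑ i, (σ i : ℝ) • basisVec i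

/-- The first of the two outward normals at an edge of the cube, in the cyclic order of the
coordinates that follow the direction of the edge. -/
def edgeNormalPlus (σ : Fin 3 → SignType) : E3 :=
  ∑ k, if σ k = 0 then (σ (k + 1) : ℝ) • basisVec (k + 1) else 0

/-- The second of the two outward normals at an edge of the cube. -/
def edgeNormalMinus (σ : Fin 3 → SignType) : E3 :=
  ∑ k, if σ k = 0 then (σ (k + 2) : ℝ) • basisVec (k + 2) else 0

theorem card_zeros {k : ℕ} {σ : Fin 3 → SignType} (hσ : σ ∈ cellIndices k) :
    Fintype.card {i // σ i = 0} = 3 - k := by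
  have h := (Finset.mem_filter.1 hσ).2
  have := Finset.card_filter_add_card_filter_not (s := Finset.univ) (fun i : Fin 3 => σ i = 0)
  rw [Fintype.card_subtype]
  simp only [Finset.card_univ, Fintype.card_fin, ne_eq] at this h
  rw [← h]
  exact Nat.eq_sub_of_add_eq this

theorem signature_of_mem_cell {c : E3} {δ : ℝ} (hδ : 0 < δ) {σ : Fin 3 → SignType} {x : E3}
    (hx : x ∈ cell c δ σ) : signature c δ x = σ := by
  funext i
  have := hx i
  unfold signature
  split_ifs at this with h
  · rw [if_pos this, h]
  · rw [this, add_sub_cancel_left]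
    cases hs : σ i <;> simp_all [abs_of_pos]

theorem mem_cell_signature {c : E3} {δ : ℝ} {x : E3} (hδ : 0 < δ)
    (hx : x ∈ closedCube c δ) : x ∈ cell c δ (signature c δ x) := by
  intro i
  have hi := hx i
  unfold signature
  rcases hi.lt_or_eq with h | h
  · simp [h]
  · rcases (abs_eq hδ.le).1 h with h' | h'
    · have : x i = c i + δ := by linarith
      simp [this, abs_of_pos hδ, hδ]
    · have : x i = c i - δ := by linarith
      simp [this, abs_of_pos hδ, hδ, sub_eq_add_neg]

theorem cell_disjoint {c : E3} {δ : ℝ} (hδ : 0 < δ) {σ τ : Fin 3 → SignType} (h : σ ≠ τ) :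
    Disjoint (cell c δ σ) (cell c δ τ) :=
  Set.disjoint_left.2 fun _ h₁ h₂ => h
    ((signature_of_mem_cell hδ h₁).symm.trans (signature_of_mem_cell hδ h₂))

/-- A small move can free a fixed coordinate, but it can neither fix a free one nor flip a sign,
because the inequalities involved are strict. -/
theorem eventually_signature {c : E3} {δ : ℝ} (hδ : 0 < δ) {σ : Fin 3 → SignType} {x : E3}
    (hx : x ∈ cell c δ σ) :
    ∀ᶠ y in 𝓝 x, ∀ i, signature c δ y i = 0 ∨ signature c δ y i = σ i := by
  rw [eventually_all]
  intro i
  have hc : Continuous fun y : E3 => y i - c i := by fun_prop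
  have := hx i
  split_ifs at this with h
  · filter_upwards [hc.abs.continuousAt.eventually_lt_const this] with y hy
    exact Or.inl (if_pos hy)
  · have hsgn : ∀ᶠ y in 𝓝 x, SignType.sign (y i - c i) = σ i := by
      have hx' : x i - c i = σ i * δ := by rw [this]; ring
      cases hs : σ i with
      | zero => exact absurd hs h
      | pos =>
        rw [hs] at hx'
        filter_upwards [hc.continuousAt.eventually_const_lt (show 0 < x i - c i by simp [hx', hδ])]
          with y hy using sign_pos hy
      | neg =>
        rw [hs] at hx'
        filter_upwards [hc.continuousAt.eventually_lt_const (show x i - c i < 0 by simp [hx', hδ])]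
          with y hy using sign_neg hy
    filter_upwards [hsgn] with y hy
    unfold signature
    split_ifs
    · exact Or.inl rfl
    · exact Or.inr hy

theorem mem_skeleton_iff {c : E3} {δ : ℝ} {k : ℕ} {x : E3} :
    x ∈ skeleton c δ k ↔ ∃ σ ∈ cellIndices k, x ∈ cell c δ σ := by
  simp [skeleton]

/-- Freeing a coordinate lowers the codimension, so inside one skeleton each cell is relatively
open. This makes the normal locally constant on the faces. -/
theorem eventually_mem_cell {c : E3} {δ : ℝ} (hδ : 0 < δ) {k : ℕ} {σ : Fin 3 → SignType}
    (hσ : σ ∈ cellIndices k) {x : E3} (hx : x ∈ cell c δ σ) :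
    ∀ᶠ y in 𝓝[skeleton c δ k] x, y ∈ cell c δ σ := by
  filter_upwards [(eventually_signature hδ hx).filter_mono nhdsWithin_le_nhds,
    self_mem_nhdsWithin] with y hy hyk
  obtain ⟨τ, hτ, hyτ⟩ := mem_skeleton_iff.1 hyk
  rw [signature_of_mem_cell hδ hyτ] at hy
  -- Nested sets of fixed coordinates with equal cardinality `k` coincide.
  have hsub : (Finset.univ.filter fun i => τ i ≠ 0) ⊆ Finset.univ.filter fun i => σ i ≠ 0 := by
    intro i hi
    simp only [Finset.mem_filter, Finset.mem_univ, true_and] at hi ⊢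
    rwa [← (hy i).resolve_left hi]
  have heq := Finset.eq_of_subset_of_card_le hsub
    ((Finset.mem_filter.1 hσ).2.trans (Finset.mem_filter.1 hτ).2.symm).le
  have : τ = σ := by
    funext i
    by_cases h : τ i = 0
    · have : i ∉ Finset.univ.filter fun i => σ i ≠ 0 := by rw [← heq]; simp [h]
      simp only [Finset.mem_filter, Finset.mem_univ, true_and, not_not] at this
      rw [h, this]
    · exact (hy i).resolve_left h
  rwa [← this]

/-- Near a point of a cell, the open cube is cut out by the half-spaces of the fixed
coordinates. -/
theorem eventually_mem_openCube_iff {c : E3} {δ : ℝ} (hδ : 0 < δ) {σ : Fin 3 → SignType} {x : E3}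
    (hx : x ∈ cell c δ σ) :
    ∀ᶠ y in 𝓝 x, y ∈ cell c δ 0 ↔ ∀ i, σ i ≠ 0 → (σ i : ℝ) * (y i - x i) < 0 := by
  have h : ∀ i, ∀ᶠ y in 𝓝 x,
      (|y i - c i| < δ ↔ (σ i ≠ 0 → (σ i : ℝ) * (y i - x i) < 0)) := by
    intro i
    have hc : Continuous fun y : E3 => |y i - c i| := by fun_prop
    have hc' : Continuous fun y : E3 => |y i - x i| := by fun_prop
    have := hx i
    split_ifs at this with hi
    · filter_upwards [hc.continuousAt.eventually_lt_const this] with y hy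
      simp [hy, hi]
    · filter_upwards [hc'.continuousAt.eventually_lt_const (show |x i - x i| < δ by simpa)]
        with y hy
      rw [abs_lt] at hy ⊢
      rw [this] at hy ⊢
      cases hs : σ i with
      | zero => exact absurd hs hi
      | pos =>
        simp only [hs, SignType.pos_eq_one, SignType.coe_one, one_mul] at hy ⊢
        constructor
        · intro h _; linarith [h.2]
        · intro h; have := h (by decide); constructor <;> linarith [hy.1]
      | neg =>
        simp only [hs, SignType.neg_eq_neg_one, SignType.coe_neg_one, neg_mul, one_mul] at hy ⊢
        constructor
        · intro h _; linarith [h.1]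
        · intro h; have := h (by decide); constructor <;> linarith [hy.2]
  filter_upwards [eventually_all.2 h] with y hy
  simp only [cell, Set.mem_ofPred_eq, Pi.zero_apply, if_true]
  exact forall_congr' hy

/-! ### The open cube as a part: normals, edge frames, vertices. -/

theorem inner_basisVec (i : Fin 3) (x : E3) : ⟪basisVec i, x⟫_ℝ = x i := by
  simp [basisVec, PiLp.inner_apply]

theorem basisVec_apply (i j : Fin 3) : basisVec i j = if j = i then 1 else 0 := by
  simp [basisVec]

theorem signType_cast_mul_self {s : SignType} (hs : s ≠ 0) : (s : ℝ) * s = 1 := by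
  cases s <;> simp_all

theorem norm_sign_smul_basisVec {s : SignType} (hs : s ≠ 0) (i : Fin 3) :
    ‖(s : ℝ) • basisVec i‖ = 1 := by
  rw [norm_smul]
  cases s <;> simp_all [basisVec]

theorem contDiff_inner_sub (v x : E3) : ContDiff ℝ ∞ fun y : E3 => ⟪v, y - x⟫_ℝ :=
  contDiff_const.inner ℝ (contDiff_id.sub contDiff_const)

theorem gradient_inner_sub (v x y : E3) : gradient (fun y : E3 => ⟪v, y - x⟫_ℝ) y = v := by
  refine HasGradientAt.gradient ?_
  rw [hasGradientAt_iff_hasFDerivAt]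
  exact ((innerSL ℝ v).hasFDerivAt (x := y - x)).comp y ((hasFDerivAt_id y).sub_const x)

theorem exists_of_mem_cellIndices_one {σ : Fin 3 → SignType} (hσ : σ ∈ cellIndices 1) :
    ∃ i s, s ≠ 0 ∧ σ = Pi.single i s := by
  revert σ; decide +revert

theorem exists_of_mem_cellIndices_two {σ : Fin 3 → SignType} (hσ : σ ∈ cellIndices 2) :
    ∃ k, σ k = 0 ∧ σ (k + 1) ≠ 0 ∧ σ (k + 2) ≠ 0 := by
  revert σ; decide +revert

theorem cellNormal_single (i : Fin 3) (s : SignType) :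
    cellNormal (Pi.single i s) = (s : ℝ) • basisVec i := by
  rw [cellNormal, Finset.sum_eq_single i]
  · simp
  · intro j _ hj; simp [hj]
  · simp

theorem isOpen_cell_zero (c : E3) (δ : ℝ) : IsOpen (cell c δ 0) := by
  simp only [cell, Pi.zero_apply, if_true, Set.ofPred_forall]
  exact isOpen_iInter_of_finite fun i =>
    isOpen_lt (f := fun x : E3 => |x i - c i|) (by fun_prop) continuous_const

theorem closure_cell_zero (c : E3) {δ : ℝ} (hδ : 0 < δ) :
    closure (cell c δ 0) = closedCube c δ := by
  refine Set.Subset.antisymm (closure_minimal (cell_subset_closedCube hδ 0)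
    (isCompact_closedCube c δ).isClosed) fun x hx => ?_
  have hcell : cell c δ 0 = (EuclideanSpace.equiv (Fin 3) ℝ).toHomeomorph ⁻¹'
      (Set.univ.pi fun i => Set.Ioo (c i - δ) (c i + δ)) := by
    ext x
    simp only [cell, Set.mem_ofPred_eq, Set.mem_preimage, Set.mem_pi, Set.mem_univ,
      forall_true_left, Set.mem_Ioo, abs_lt, Pi.zero_apply, if_true]
    refine forall_congr' fun i => ?_
    change _ ↔ c i - δ < x i ∧ x i < c i + δ
    constructor <;> intro h <;> constructor <;> linarith [h.1, h.2]
  rw [hcell, ← Homeomorph.preimage_closure, closure_pi_set]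
  intro i _
  beta_reduce
  rw [closure_Ioo (by linarith : c i - δ < c i + δ).ne]
  change c i - δ ≤ x i ∧ x i ≤ c i + δ
  have := abs_le.1 (hx i)
  constructor <;> linarith [this.1, this.2]

theorem frontier_cell_zero (c : E3) {δ : ℝ} (hδ : 0 < δ) :
    frontier (cell c δ 0) = skeleton c δ 1 ∪ skeleton c δ 2 ∪ skeleton c δ 3 := by
  rw [(isOpen_cell_zero c δ).frontier_eq, closure_cell_zero c hδ]
  ext x
  simp only [Set.mem_sdiff, Set.mem_union, mem_skeleton_iff]
  constructor
  · rintro ⟨hx, hx0⟩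
    have hmem := mem_cell_signature hδ hx
    have hne : signature c δ x ≠ 0 := fun h => hx0 (h ▸ hmem)
    -- A non-zero index fixes one, two or three coordinates; there are only 27 indices to check.
    have key : ∀ σ : Fin 3 → SignType, σ ≠ 0 →
        (σ ∈ cellIndices 1 ∨ σ ∈ cellIndices 2) ∨ σ ∈ cellIndices 3 := by decide
    rcases key _ hne with (h | h) | h
    · exact Or.inl (Or.inl ⟨_, h, hmem⟩)
    · exact Or.inl (Or.inr ⟨_, h, hmem⟩)
    · exact Or.inr ⟨_, h, hmem⟩
  · have key : ∀ k, k ≠ 0 → ∀ σ ∈ cellIndices k, x ∈ cell c δ σ →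
        x ∈ closedCube c δ ∧ x ∉ cell c δ 0 := by
      refine fun k hk σ hσ hx => ⟨cell_subset_closedCube hδ σ hx, fun h0 => hk ?_⟩
      have : σ = 0 := (signature_of_mem_cell hδ hx).symm.trans (signature_of_mem_cell hδ h0)
      have hcard := (Finset.mem_filter.1 hσ).2
      simpa [this] using hcard.symm
    rintro ((⟨σ, hσ, hx⟩ | ⟨σ, hσ, hx⟩) | ⟨σ, hσ, hx⟩)
    exacts [key 1 (by decide) σ hσ hx, key 2 (by decide) σ hσ hx, key 3 (by decide) σ hσ hx]

theorem finite_skeleton_three (c : E3) (δ : ℝ) : (skeleton c δ 3).Finite := by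
  refine (Finset.finite_toSet _).biUnion fun σ hσ => Set.Subsingleton.finite ?_
  have key : ∀ σ ∈ cellIndices 3, ∀ i, σ i ≠ 0 := by decide
  intro x hx y hy
  ext i
  have h := key σ hσ i
  have h₁ := hx i
  have h₂ := hy i
  rw [if_neg h] at h₁ h₂
  rw [h₁, h₂]

theorem isOutwardNormal_cell {c : E3} {δ : ℝ} (hδ : 0 < δ) {σ : Fin 3 → SignType}
    (hσ : σ ∈ cellIndices 1) {x : E3} (hx : x ∈ cell c δ σ) :
    IsOutwardNormal (cell c δ 0) x (cellNormal σ) := by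
  have hev := eventually_mem_openCube_iff hδ hx
  obtain ⟨i, s, hs, rfl⟩ := exists_of_mem_cellIndices_one hσ
  have hn := norm_sign_smul_basisVec hs i
  rw [cellNormal_single]
  refine ⟨fun y => ⟪(s : ℝ) • basisVec i, y - x⟫_ℝ, (contDiff_inner_sub _ _).contDiffAt, by simp,
    ?_, ?_, ?_⟩
  · rw [gradient_inner_sub, ← norm_ne_zero_iff, hn]; exact one_ne_zero
  · filter_upwards [hev] with y hy
    rw [hy, real_inner_smul_left, inner_basisVec]
    constructor
    · intro h; simpa using h i (by simpa using hs)
    · intro h j hj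
      have : j = i := by by_contra hne; simp [hne] at hj
      subst this; simpa using h
  · rw [gradient_inner_sub, hn, inv_one, one_smul]

theorem eq_add_one_or_eq_add_two {j k : Fin 3} (h : j ≠ k) : j = k + 1 ∨ j = k + 2 := by
  decide +revert

theorem add_one_ne_add_two (k : Fin 3) : k + 1 ≠ k + 2 := by
  decide +revert

theorem edgeNormalPlus_eq {σ : Fin 3 → SignType} {k : Fin 3} (h0 : σ k = 0) (h1 : σ (k + 1) ≠ 0)
    (h2 : σ (k + 2) ≠ 0) : edgeNormalPlus σ = (σ (k + 1) : ℝ) • basisVec (k + 1) := by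
  rw [edgeNormalPlus, Finset.sum_eq_single k]
  · simp [h0]
  · intro j _ hj
    rcases eq_add_one_or_eq_add_two hj with rfl | rfl
    exacts [if_neg h1, if_neg h2]
  · simp

theorem edgeNormalMinus_eq {σ : Fin 3 → SignType} {k : Fin 3} (h0 : σ k = 0) (h1 : σ (k + 1) ≠ 0)
    (h2 : σ (k + 2) ≠ 0) : edgeNormalMinus σ = (σ (k + 2) : ℝ) • basisVec (k + 2) := by
  rw [edgeNormalMinus, Finset.sum_eq_single k]
  · simp [h0]
  · intro j _ hj
    rcases eq_add_one_or_eq_add_two hj with rfl | rfl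
    exacts [if_neg h1, if_neg h2]
  · simp

/-- Near a convex right-angled edge the two unit normals, exchanged, are the tangent-normals. -/
theorem isEdgeFrame_of_orthonormal {P : Set E3} {x n m : E3} (hn : ‖n‖ = 1) (hm : ‖m‖ = 1)
    (hnm : ⟪n, m⟫_ℝ = 0) (hP : ∀ᶠ y in 𝓝 x, y ∈ P ↔ ⟪n, y - x⟫_ℝ < 0 ∧ ⟪m, y - x⟫_ℝ < 0) :
    IsEdgeFrame P x n m m n := by
  have hmn : ⟪m, n⟫_ℝ = 0 := by rw [real_inner_comm, hnm]
  refine ⟨fun y => ⟪n, y - x⟫_ℝ, fun y => ⟪m, y - x⟫_ℝ, (contDiff_inner_sub _ _).contDiffAt,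
    (contDiff_inner_sub _ _).contDiffAt, by simp, by simp, ?_, ?_, ?_, hm, hmn,
    Submodule.subset_span (by simp), hn, hnm, Submodule.subset_span (by simp),
    Or.inl ⟨hP, ?_, ?_⟩⟩
  · rw [gradient_inner_sub, gradient_inner_sub]
    refine Orthonormal.linearIndependent (𝕜 := ℝ) ⟨fun i => ?_, fun i j hij => ?_⟩
    · fin_cases i <;> simpa
    · fin_cases i <;> fin_cases j <;> simp_all
  · rw [gradient_inner_sub, hn, inv_one, one_smul]
  · rw [gradient_inner_sub, hm, inv_one, one_smul]
  · rw [real_inner_self_eq_norm_sq, hm]; norm_num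
  · rw [real_inner_self_eq_norm_sq, hn]; norm_num

theorem isEdgeFrame_cell {c : E3} {δ : ℝ} (hδ : 0 < δ) {σ : Fin 3 → SignType}
    (hσ : σ ∈ cellIndices 2) {x : E3} (hx : x ∈ cell c δ σ) :
    IsEdgeFrame (cell c δ 0) x (edgeNormalPlus σ) (edgeNormalMinus σ)
      (edgeNormalMinus σ) (edgeNormalPlus σ) := by
  obtain ⟨k, h0, h1, h2⟩ := exists_of_mem_cellIndices_two hσ
  rw [edgeNormalPlus_eq h0 h1 h2, edgeNormalMinus_eq h0 h1 h2]
  refine isEdgeFrame_of_orthonormal (norm_sign_smul_basisVec h1 _) (norm_sign_smul_basisVec h2 _)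
    ?_ ?_
  · have : k + 1 ≠ k + 2 := add_one_ne_add_two k
    simp [real_inner_smul_left, inner_basisVec, basisVec_apply, this]
  · filter_upwards [eventually_mem_openCube_iff hδ hx] with y hy
    rw [hy, real_inner_smul_left, inner_basisVec, real_inner_smul_left, inner_basisVec]
    constructor
    · intro h; exact ⟨h _ h1, h _ h2⟩
    · rintro h j hj
      have : j ≠ k := fun h => hj (h ▸ h0)
      rcases eq_add_one_or_eq_add_two this with rfl | rfl
      exacts [h.1, h.2]

theorem isVertex_cell {c : E3} {δ : ℝ} (hδ : 0 < δ) {σ : Fin 3 → SignType}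
    (hσ : σ ∈ cellIndices 3) {x : E3} (hx : x ∈ cell c δ σ) : IsVertex (cell c δ 0) x := by
  have key : ∀ σ ∈ cellIndices 3, ∀ i, σ i ≠ 0 := by decide
  refine ⟨fun y => y - x, (contDiff_id.sub contDiff_const).contDiffAt, sub_self x, ?_,
    {y | ∀ i, (σ i : ℝ) * y i < 0}, ?_, ?_⟩
  · rw [fderiv_sub_const]
    simp only [fderiv_fun_id]
    exact ContinuousLinearMap.isInvertible_equiv (f := ContinuousLinearEquiv.refl ℝ E3)
  · classical
    -- The cone is an octant, a single intersection of three half-spaces.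
    refine ⟨{Finset.univ.image fun i => (σ i : ℝ) • basisVec i}, ?_⟩
    ext y
    simp [real_inner_smul_left, inner_basisVec]
  · filter_upwards [eventually_mem_openCube_iff hδ hx] with y hy
    rw [hy]
    exact forall_congr' fun i => by simp [key σ hσ i]

/-- The open cube as a part of the body. -/
def cubePart {B : Set E3} (c : E3) {δ : ℝ} (hδ : 0 < δ) (h : closedCube c δ ⊆ B) : Part B where
  region := cell c δ 0
  isOpen_region := isOpen_cell_zero c δ
  isBounded_region := (isCompact_closedCube c δ).isBounded.subset (cell_subset_closedCube hδ 0)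
  closure_subset := (closure_cell_zero c hδ).trans_subset h
  face := skeleton c δ 1
  edge := skeleton c δ 2
  vertices := skeleton c δ 3
  finite_vertices := finite_skeleton_three c δ
  frontier_eq := frontier_cell_zero c hδ
  normal x := cellNormal (signature c δ x)
  isOutwardNormal x hx := by
    obtain ⟨σ, hσ, hxσ⟩ := mem_skeleton_iff.1 hx
    rw [signature_of_mem_cell hδ hxσ]
    exact isOutwardNormal_cell hδ hσ hxσ
  normalPlus x := edgeNormalPlus (signature c δ x)
  normalMinus x := edgeNormalMinus (signature c δ x)
  tangentNormalPlus x := edgeNormalMinus (signature c δ x)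
  tangentNormalMinus x := edgeNormalPlus (signature c δ x)
  isEdgeFrame x hx := by
    obtain ⟨σ, hσ, hxσ⟩ := mem_skeleton_iff.1 hx
    rw [signature_of_mem_cell hδ hxσ]
    exact isEdgeFrame_cell hδ hσ hxσ
  isVertex x hx := by
    obtain ⟨σ, hσ, hxσ⟩ := mem_skeleton_iff.1 hx
    exact isVertex_cell hδ hσ hxσ

/-! ### Microtractions on the cube. -/

/-- The surface microtraction on a face of the cube, written out in coordinates. -/
def faceTraction (ζ : E3 → E3) (S : E3 → Tensor) (σ : Fin 3 → SignType) (x : E3) : ℝ :=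
  ⟪ζ x, cellNormal σ⟫_ℝ -
    ∑ j, if σ j = 0 then ⟪basisVec j, fderiv ℝ S x (basisVec j) (cellNormal σ)⟫_ℝ else 0

/-- The internal-edge microtraction on an edge of the cube. -/
def edgeTraction (S : E3 → Tensor) (σ : Fin 3 → SignType) (x : E3) : ℝ :=
  ⟪edgeNormalMinus σ, S x (edgeNormalPlus σ)⟫_ℝ + ⟪edgeNormalPlus σ, S x (edgeNormalMinus σ)⟫_ℝ

/-- A short segment through `x` in a free direction stays in the cell. A derivative within a face is
not unique on the whole space; it is determined on such tangent vectors. -/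
theorem basisVec_mem_tangentConeAt {c : E3} {δ : ℝ} {k : ℕ} {σ : Fin 3 → SignType}
    (hσ : σ ∈ cellIndices k) {x : E3} (hx : x ∈ cell c δ σ) {j : Fin 3} (hj : σ j = 0) :
    basisVec j ∈ tangentConeAt ℝ (skeleton c δ k) x := by
  have hlim : Tendsto (fun t : ℝ => t • basisVec j) (𝓝[≠] 0) (𝓝 0) := by
    have : Continuous fun t : ℝ => t • basisVec j := by fun_prop
    simpa using (this.tendsto 0).mono_left nhdsWithin_le_nhds
  refine mem_tangentConeAt_of_seq (𝓝[≠] (0 : ℝ)) (fun t => t⁻¹) (fun t => t • basisVec j)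
    hlim ?_ ?_
  · have hc : Continuous fun t : ℝ => |x j + t - c j| := by fun_prop
    have hxj := hx j
    rw [if_pos hj] at hxj
    have hev : ∀ᶠ t : ℝ in 𝓝 0, |x j + t - c j| < δ :=
      hc.continuousAt.eventually_lt_const (by simpa using hxj)
    filter_upwards [hev.filter_mono nhdsWithin_le_nhds] with t ht
    refine mem_skeleton_iff.2 ⟨σ, hσ, fun i => ?_⟩
    by_cases hij : i = j
    · subst hij
      simpa [hj, basisVec_apply] using ht
    · simpa [hij, basisVec_apply] using hx i
  · refine tendsto_const_nhds.congr' ?_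
    filter_upwards [self_mem_nhdsWithin] with t ht
    rw [smul_smul, inv_mul_cancel₀ ht, one_smul]

theorem tangentProj_apply (n v : E3) : tangentProj n v = v - ⟪n, v⟫_ℝ • n := rfl

/-- The normal is constant along a face, so the field there is the restriction of one that is
differentiable in space. The normal direction is killed by the projection in `surfGrad`; in a
tangential direction the projection inside the field does not affect the component taken. -/
theorem surfDiv_cell {c : E3} {δ : ℝ} (hδ : 0 < δ) {σ : Fin 3 → SignType}
    (hσ : σ ∈ cellIndices 1) {x : E3} (hx : x ∈ cell c δ σ) {S : E3 → Tensor}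
    (hS : DifferentiableAt ℝ S x) :
    surfDiv (skeleton c δ 1) (cellNormal (signature c δ x))
      (fun y => tangentProj (cellNormal (signature c δ y))
        (S y (cellNormal (signature c δ y)))) x =
      ∑ j, if σ j = 0 then ⟪basisVec j, fderiv ℝ S x (basisVec j) (cellNormal σ)⟫_ℝ else 0 := by
  rw [signature_of_mem_cell hδ hx]
  set g := fun y => tangentProj (cellNormal (signature c δ y)) (S y (cellNormal (signature c δ y)))
  have hG : HasFDerivAt (fun y => tangentProj (cellNormal σ) (S y (cellNormal σ)))
      ((tangentProj (cellNormal σ)).comp ((fderiv ℝ S x).flip (cellNormal σ))) x := by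
    have h := hS.hasFDerivAt.clm_apply (hasFDerivAt_const (cellNormal σ) x)
    refine ((tangentProj (cellNormal σ)).hasFDerivAt.comp x h).congr_fderiv ?_
    simp
  have hg : HasFDerivWithinAt g
      ((tangentProj (cellNormal σ)).comp ((fderiv ℝ S x).flip (cellNormal σ)))
      (skeleton c δ 1) x := by
    refine hG.hasFDerivWithinAt.congr_of_eventuallyEq ?_ ?_
    · filter_upwards [eventually_mem_cell hδ hσ hx] with y hy
      simp only [g, signature_of_mem_cell hδ hy]
    · simp only [g, signature_of_mem_cell hδ hx]
  -- `fderivWithin` and the computed derivative are compared on the tangent cone only, where they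
  -- must agree.
  have huniq := hg.differentiableWithinAt.hasFDerivWithinAt.unique_on hg
  obtain ⟨i, s, hs, rfl⟩ := exists_of_mem_cellIndices_one hσ
  rw [surfDiv, tensorTrace]
  refine Finset.sum_congr rfl fun j _ => ?_
  by_cases hj : j = i
  · subst hj
    have : tangentProj (cellNormal (Pi.single j s)) (basisVec j) = 0 := by
      rw [tangentProj_apply, cellNormal_single, real_inner_smul_left, inner_basisVec, smul_smul]
      simp [basisVec_apply, signType_cast_mul_self hs]
    simp [surfGrad, this, hs]
  · have h0 : (Pi.single i s : Fin 3 → SignType) j = 0 := by simp [hj]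
    have : tangentProj (cellNormal (Pi.single i s)) (basisVec j) = basisVec j := by
      rw [tangentProj_apply, cellNormal_single, real_inner_smul_left, inner_basisVec]
      simp [basisVec_apply, Ne.symm hj]
    have hn : ⟪basisVec j, cellNormal (Pi.single i s)⟫_ℝ = 0 := by
      rw [cellNormal_single, inner_basisVec]
      simp [basisVec_apply, hj]
    rw [surfGrad, ContinuousLinearMap.comp_apply, this,
      huniq (basisVec_mem_tangentConeAt hσ hx h0), if_pos h0, ContinuousLinearMap.comp_apply,
      tangentProj_apply, inner_sub_right, inner_smul_right, hn, mul_zero, sub_zero,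
      ContinuousLinearMap.flip_apply]

theorem surfaceMicrotraction_cubePart {B : Set E3} {c : E3} {δ : ℝ} (hδ : 0 < δ)
    (hc : closedCube c δ ⊆ B) (ζ : E3 → E3) {S : E3 → Tensor} {σ : Fin 3 → SignType}
    (hσ : σ ∈ cellIndices 1) {x : E3} (hx : x ∈ cell c δ σ) (hS : DifferentiableAt ℝ S x) :
    surfaceMicrotraction (cubePart c hδ hc) ζ S x = faceTraction ζ S σ x := by
  have h := surfDiv_cell hδ hσ hx hS
  have hn : (cubePart c hδ hc).normal x = cellNormal σ := by
    simp only [cubePart, signature_of_mem_cell hδ hx]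
  rw [faceTraction, ← h, surfaceMicrotraction, hn]
  rw [signature_of_mem_cell hδ hx]
  rfl

theorem internalEdgeMicrotraction_cubePart {B : Set E3} {c : E3} {δ : ℝ} (hδ : 0 < δ)
    (hc : closedCube c δ ⊆ B) (S : E3 → Tensor) {σ : Fin 3 → SignType} {x : E3}
    (hx : x ∈ cell c δ σ) :
    internalEdgeMicrotraction (cubePart c hδ hc) S x = edgeTraction S σ x := by
  simp only [internalEdgeMicrotraction, edgeTraction, cubePart, signature_of_mem_cell hδ hx]

/-! ### The balances on the cube as sums of cell integrals. -/

theorem setIntegral_skeleton {E : Type*} [NormedAddCommGroup E] [NormedSpace ℝ E] {c : E3} {δ : ℝ}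
    (hδ : 0 < δ) {k d : ℕ} (hd : 3 - k = d) {F : E3 → E} {G : (Fin 3 → SignType) → E3 → E}
    (hG : ∀ σ ∈ cellIndices k, ContinuousOn (G σ) (closedCube c δ))
    (hF : ∀ σ ∈ cellIndices k, Set.EqOn F (G σ) (cell c δ σ)) :
    ∫ x in skeleton c δ k, F x ∂μHE[d] = ∑ σ ∈ cellIndices k, cellIntegral c δ σ (G σ) := by
  rw [skeleton, integral_biUnion_finset _ (fun σ _ => measurableSet_cell c δ σ)
    fun σ _ τ _ h => cell_disjoint hδ h]
  · refine Finset.sum_congr rfl fun σ hσ => ?_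
    rw [setIntegral_congr_fun (measurableSet_cell c δ σ) (hF σ hσ),
      setIntegral_cell c δ σ ((card_zeros hσ).trans hd)]
  · intro σ hσ
    exact (integrableOn_cell hδ σ ((card_zeros hσ).trans hd) (hG σ hσ)).congr_fun
      (hF σ hσ).symm (measurableSet_cell c δ σ)

theorem setIntegral_openCube {E : Type*} [NormedAddCommGroup E] [NormedSpace ℝ E] (c : E3) (δ : ℝ)
    (h : E3 → E) : ∫ x in cell c δ 0, h x = cellIntegral c δ 0 h := by
  rw [← setIntegral_cell c δ 0 (d := 3) (by simp),
    EuclideanSpace.euclideanHausdorffMeasure_eq_volume]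

theorem continuousOn_faceTraction {B : Set E3} (hB : IsOpen B) {ζ : E3 → E3} {S : E3 → Tensor}
    (hζ : ContinuousOn ζ B) (hS : ContDiffOn ℝ 1 S B) (σ : Fin 3 → SignType) :
    ContinuousOn (faceTraction ζ S σ) B := by
  have hS' := hS.continuousOn_fderiv_of_isOpen hB le_rfl
  refine (hζ.inner continuousOn_const).sub (continuousOn_finsetSum _ fun j _ => ?_)
  split_ifs
  · exact continuousOn_const.inner
      ((hS'.clm_apply continuousOn_const).clm_apply continuousOn_const)
  · exact continuousOn_const

theorem continuousOn_edgeTraction {B : Set E3} {S : E3 → Tensor}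
    (hS : ContinuousOn S B) (σ : Fin 3 → SignType) : ContinuousOn (edgeTraction S σ) B :=
  (continuousOn_const.inner (hS.clm_apply continuousOn_const)).add
    (continuousOn_const.inner (hS.clm_apply continuousOn_const))

theorem cellIntegral_force_balance {B : Set E3} (hB : IsOpen B) {c : E3} {δ : ℝ} (hδ : 0 < δ)
    (hc : closedCube c δ ⊆ B) {ζ : E3 → E3} {S : E3 → Tensor} {π γ : E3 → ℝ}
    (hζ : ContinuousOn ζ B) (hS : ContDiffOn ℝ 1 S B)
    (h : MicroforceBalance (cubePart c hδ hc) ζ S π γ) :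
    cellIntegral c δ 0 (fun x => π x + γ x) +
      ∑ σ ∈ cellIndices 1, cellIntegral c δ σ (faceTraction ζ S σ) +
      ∑ σ ∈ cellIndices 2, cellIntegral c δ σ (edgeTraction S σ) = 0 := by
  rw [MicroforceBalance] at h
  rw [← h, ← setIntegral_openCube,
    ← setIntegral_skeleton hδ (d := 2) rfl
      (F := surfaceMicrotraction (cubePart c hδ hc) ζ S)
      (fun σ _ => (continuousOn_faceTraction hB hζ hS σ).mono hc)
      (fun σ hσ x hx => surfaceMicrotraction_cubePart hδ hc ζ hσ hx
        ((hS.differentiableOn one_ne_zero).differentiableAt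
          (hB.mem_nhds (hc (cell_subset_closedCube hδ σ hx))))),
    ← setIntegral_skeleton hδ (d := 1) rfl
      (F := internalEdgeMicrotraction (cubePart c hδ hc) S)
      (fun σ _ => (continuousOn_edgeTraction hS.continuousOn σ).mono hc)
      (fun σ hσ x hx => internalEdgeMicrotraction_cubePart hδ hc S hx)]
  rfl

theorem cellIntegral_torque_balance {B : Set E3} (hB : IsOpen B) {c : E3} {δ : ℝ} (hδ : 0 < δ)
    (hc : closedCube c δ ⊆ B) {o : E3} {ζ ξ : E3 → E3} {S : E3 → Tensor} {π γ : E3 → ℝ}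
    (hζ : ContinuousOn ζ B) (hS : ContDiffOn ℝ 1 S B)
    (h : MicrotorqueBalance (cubePart c hδ hc) o ζ ξ S π γ) :
    cellIntegral c δ 0 (fun x => (π x + γ x) • (x - o) - ξ x) +
      ∑ σ ∈ cellIndices 1, cellIntegral c δ σ (fun x => faceTraction ζ S σ x • (x - o) +
        ⟪cellNormal σ, S x (cellNormal σ)⟫_ℝ • cellNormal σ) +
      ∑ σ ∈ cellIndices 2, cellIntegral c δ σ (fun x => edgeTraction S σ x • (x - o)) = 0 := by
  have hr : ContinuousOn (fun x : E3 => x - o) B := by fun_prop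
  have hG : ∀ σ, ContinuousOn (fun x => faceTraction ζ S σ x • (x - o) +
      ⟪cellNormal σ, S x (cellNormal σ)⟫_ℝ • cellNormal σ) B := fun σ => by
    have h₁ : ContinuousOn (fun x => ⟪cellNormal σ, S x (cellNormal σ)⟫_ℝ) B :=
      continuousOn_const.inner (hS.continuousOn.clm_apply continuousOn_const)
    exact ((continuousOn_faceTraction hB hζ hS σ).smul hr).add (h₁.smul continuousOn_const)
  have hF : ∀ σ ∈ cellIndices 1, Set.EqOn
      (fun x => surfaceMicrotraction (cubePart c hδ hc) ζ S x • (x - o) +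
        surfaceCoupleMicrotraction (cubePart c hδ hc) S x)
      (fun x => faceTraction ζ S σ x • (x - o) +
        ⟪cellNormal σ, S x (cellNormal σ)⟫_ℝ • cellNormal σ) (cell c δ σ) := by
    intro σ hσ x hx
    have hn : (cubePart c hδ hc).normal x = cellNormal σ := by
      simp only [cubePart, signature_of_mem_cell hδ hx]
    have h := surfaceMicrotraction_cubePart hδ hc ζ hσ hx
      ((hS.differentiableOn one_ne_zero).differentiableAt
        (hB.mem_nhds (hc (cell_subset_closedCube hδ σ hx))))
    simp only [h, surfaceCoupleMicrotraction, hn]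
  have hface := setIntegral_skeleton hδ (d := 2) rfl (fun σ _ => (hG σ).mono hc) hF
  have hedge := setIntegral_skeleton hδ (k := 2) (d := 1) rfl
    (F := fun x => internalEdgeMicrotraction (cubePart c hδ hc) S x • (x - o))
    (G := fun σ x => edgeTraction S σ x • (x - o))
    (fun σ _ => ((continuousOn_edgeTraction hS.continuousOn σ).smul hr).mono hc)
    (fun σ hσ x hx => by
      simp only [internalEdgeMicrotraction_cubePart hδ hc S hx])
  rw [← setIntegral_openCube, ← hface, ← hedge]
  exact h

/-! ### Enumeration of faces and edges, and tractions in components. -/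

/-- The index of an edge of the cube in direction `k`. -/
def edgeIndex (k : Fin 3) (s s' : SignType) : Fin 3 → SignType :=
  Function.update (Pi.single (k + 1) s) (k + 2) s'

theorem sum_cellIndices_one {M : Type*} [AddCommMonoid M] (F : (Fin 3 → SignType) → M) :
    ∑ σ ∈ cellIndices 1, F σ = ∑ i, (F (Pi.single i 1) + F (Pi.single i (-1))) := by
  have h : cellIndices 1 = (Finset.univ ×ˢ {1, -1}).image
      fun p : Fin 3 × SignType => Pi.single p.1 p.2 := by decide
  rw [h, Finset.sum_image (by decide), Finset.sum_product]
  exact Finset.sum_congr rfl fun i _ => Finset.sum_pair (by decide)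

theorem sum_cellIndices_two {M : Type*} [AddCommMonoid M] (F : (Fin 3 → SignType) → M) :
    ∑ σ ∈ cellIndices 2, F σ = ∑ k, ((F (edgeIndex k 1 1) + F (edgeIndex k 1 (-1))) +
      (F (edgeIndex k (-1) 1) + F (edgeIndex k (-1) (-1)))) := by
  have h : cellIndices 2 = (Finset.univ ×ˢ ({1, -1} ×ˢ {1, -1})).image
      fun p : Fin 3 × SignType × SignType => edgeIndex p.1 p.2.1 p.2.2 := by decide
  rw [h, Finset.sum_image (by decide), Finset.sum_product]
  refine Finset.sum_congr rfl fun i _ => ?_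
  rw [Finset.sum_product, Finset.sum_pair (by decide), Finset.sum_pair (by decide),
    Finset.sum_pair (by decide)]

/-- An edge arises as an end of either of its two adjacent faces; `edgeIndex` reaches it from one of
them, this equality from the other. -/
theorem update_single_add_one (k : Fin 3) (s s' : SignType) :
    Function.update (Pi.single (k + 2) s') (k + 1) s = edgeIndex k s s' := by
  decide +revert

theorem add_one_ne_self (k : Fin 3) : k + 1 ≠ k := by decide +revert

theorem add_two_ne_self (k : Fin 3) : k + 2 ≠ k := by decide +revert

theorem sum_add_one (F : Fin 3 → ℝ) : ∑ k, F (k + 1) = ∑ k, F k :=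
  Equiv.sum_comp (Equiv.addRight 1) F

theorem sum_add_two (F : Fin 3 → ℝ) : ∑ k, F (k + 2) = ∑ k, F k :=
  Equiv.sum_comp (Equiv.addRight 2) F

theorem edgeNormalPlus_edgeIndex (k : Fin 3) {s s' : SignType} (hs : s ≠ 0) (hs' : s' ≠ 0) :
    edgeNormalPlus (edgeIndex k s s') = (s : ℝ) • basisVec (k + 1) := by
  have h : edgeIndex k s s' k = 0 ∧ edgeIndex k s s' (k + 1) = s ∧
      edgeIndex k s s' (k + 2) = s' := by decide +revert
  rw [edgeNormalPlus_eq h.1 (h.2.1.trans_ne hs) (h.2.2.trans_ne hs'), h.2.1]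

theorem edgeNormalMinus_edgeIndex (k : Fin 3) {s s' : SignType} (hs : s ≠ 0) (hs' : s' ≠ 0) :
    edgeNormalMinus (edgeIndex k s s') = (s' : ℝ) • basisVec (k + 2) := by
  have h : edgeIndex k s s' k = 0 ∧ edgeIndex k s s' (k + 1) = s ∧
      edgeIndex k s s' (k + 2) = s' := by decide +revert
  rw [edgeNormalMinus_eq h.1 (h.2.1.trans_ne hs) (h.2.2.trans_ne hs'), h.2.2]

/-- The components of a tensor field. -/
def entry (S : E3 → Tensor) (j i : Fin 3) (x : E3) : ℝ := ⟪basisVec j, S x (basisVec i)⟫_ℝ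

theorem edgeTraction_edgeIndex (S : E3 → Tensor) (k : Fin 3) {s s' : SignType} (hs : s ≠ 0)
    (hs' : s' ≠ 0) (x : E3) :
    edgeTraction S (edgeIndex k s s') x =
      (s : ℝ) * s' * (entry S (k + 2) (k + 1) x + entry S (k + 1) (k + 2) x) := by
  rw [edgeTraction, edgeNormalPlus_edgeIndex k hs hs', edgeNormalMinus_edgeIndex k hs hs']
  simp only [map_smul, real_inner_smul_left, real_inner_smul_right, entry]
  ring

theorem sum_ite_single (i : Fin 3) {s : SignType} (hs : s ≠ 0) (a : Fin 3 → ℝ) :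
    ∑ j, (if (Pi.single i s : Fin 3 → SignType) j = 0 then a j else 0) =
      a (i + 1) + a (i + 2) := by
  fin_cases i <;> simp [Fin.sum_univ_three, hs]
  exact add_comm _ _

theorem faceTraction_single (ζ : E3 → E3) (S : E3 → Tensor) (i : Fin 3) {s : SignType}
    (hs : s ≠ 0) (x : E3) :
    faceTraction ζ S (Pi.single i s) x = (s : ℝ) * (ζ x i -
      ⟪basisVec (i + 1), fderiv ℝ S x (basisVec (i + 1)) (basisVec i)⟫_ℝ -
      ⟪basisVec (i + 2), fderiv ℝ S x (basisVec (i + 2)) (basisVec i)⟫_ℝ) := by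
  rw [faceTraction, sum_ite_single i hs, cellNormal_single]
  simp only [map_smul, real_inner_smul_right]
  rw [real_inner_comm, inner_basisVec]
  ring

/-! ### Integration by parts and the power of the tractions. -/

section
variable {B : Set E3}

theorem contDiffOn_entry {S : E3 → Tensor} (hS : ContDiffOn ℝ 1 S B) (j i : Fin 3) :
    ContDiffOn ℝ 1 (entry S j i) B :=
  contDiffOn_const.inner ℝ (hS.clm_apply contDiffOn_const)

theorem continuousOn_fderiv_apply {h : E3 → ℝ} (hB : IsOpen B) (hh : ContDiffOn ℝ 1 h B) (v : E3) :
    ContinuousOn (fun x => fderiv ℝ h x v) B :=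
  (hh.continuousOn_fderiv_of_isOpen hB le_rfl).clm_apply continuousOn_const

theorem fderiv_entry_apply {S : E3 → Tensor} {x : E3} (hS : DifferentiableAt ℝ S x) (j i : Fin 3)
    (v : E3) : fderiv ℝ (entry S j i) x v = ⟪basisVec j, fderiv ℝ S x v (basisVec i)⟫_ℝ := by
  have h := (innerSL ℝ (basisVec j)).hasFDerivAt.comp x
    (hS.hasFDerivAt.clm_apply (hasFDerivAt_const (basisVec i) x))
  have h' : fderiv ℝ (entry S j i) x = _ := h.fderiv
  rw [h']
  simp

theorem cellIntegral_fderiv_of_contDiffOn (hB : IsOpen B) {c : E3} {δ : ℝ} (hδ : 0 < δ)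
    (hc : closedCube c δ ⊆ B) {σ : Fin 3 → SignType} {j : Fin 3} (hj : σ j = 0) {h : E3 → ℝ}
    (hh : ContDiffOn ℝ 1 h B) :
    cellIntegral c δ σ (fun x => fderiv ℝ h x (basisVec j)) =
      cellIntegral c δ (Function.update σ j 1) h - cellIntegral c δ (Function.update σ j (-1)) h :=
  cellIntegral_fderiv hδ hj
    (fun _ hx => (hh.differentiableOn one_ne_zero).differentiableAt (hB.mem_nhds (hc hx)))
    ((continuousOn_fderiv_apply hB hh _).mono hc)

/-- An affine function with gradient `a`. -/
def affineFun (a : E3) (k : ℝ) (x : E3) : ℝ := ⟪a, x⟫_ℝ + k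

theorem contDiff_affineFun (a : E3) (k : ℝ) : ContDiff ℝ 1 (affineFun a k) :=
  (contDiff_const.inner ℝ contDiff_id).add contDiff_const

theorem hasFDerivAt_affineFun (a : E3) (k : ℝ) (x : E3) :
    HasFDerivAt (affineFun a k) (innerSL ℝ a) x :=
  (innerSL ℝ a).hasFDerivAt.add_const k

theorem fderiv_mul_affineFun {h : E3 → ℝ} {x : E3} (hh : DifferentiableAt ℝ h x) (a : E3) (k : ℝ)
    (j : Fin 3) :
    fderiv ℝ (fun y => h y * affineFun a k y) x (basisVec j) =
      fderiv ℝ h x (basisVec j) * affineFun a k x + a j * h x := by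
  rw [(hh.hasFDerivAt.fun_mul (hasFDerivAt_affineFun a k x)).fderiv]
  simp only [add_apply, smul_apply, innerSL_apply_apply,
    smul_eq_mul]
  rw [real_inner_comm, inner_basisVec]
  ring

/-- The power of the traction on a face of the cube, expended over an affine field. -/
theorem cellIntegral_faceTraction_mul (hB : IsOpen B) {c : E3} {δ : ℝ} (hδ : 0 < δ)
    (hc : closedCube c δ ⊆ B) {ζ : E3 → E3} {S : E3 → Tensor}
    (hζ : ContinuousOn ζ B) (hS : ContDiffOn ℝ 1 S B) (a : E3) (k : ℝ) (i : Fin 3) {s : SignType}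
    (hs : s ≠ 0) :
    cellIntegral c δ (Pi.single i s)
        (fun x => faceTraction ζ S (Pi.single i s) x * affineFun a k x) =
      s * (cellIntegral c δ (Pi.single i s) (fun x => ζ x i * affineFun a k x) -
        (cellIntegral c δ (Function.update (Pi.single i s) (i + 1) 1)
            (fun x => entry S (i + 1) i x * affineFun a k x) -
          cellIntegral c δ (Function.update (Pi.single i s) (i + 1) (-1))
            (fun x => entry S (i + 1) i x * affineFun a k x)) -
        (cellIntegral c δ (Function.update (Pi.single i s) (i + 2) 1)
            (fun x => entry S (i + 2) i x * affineFun a k x) -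
          cellIntegral c δ (Function.update (Pi.single i s) (i + 2) (-1))
            (fun x => entry S (i + 2) i x * affineFun a k x)) +
        cellIntegral c δ (Pi.single i s)
          (fun x => a (i + 1) * entry S (i + 1) i x + a (i + 2) * entry S (i + 2) i x)) := by
  have hf := (contDiff_affineFun a k).contDiffOn (s := B)
  have hU : ∀ j, ContDiffOn ℝ 1 (fun x => entry S j i x * affineFun a k x) B := fun j =>
    (contDiffOn_entry hS j i).mul hf
  have h1 : (Pi.single i s : Fin 3 → SignType) (i + 1) = 0 :=
    Pi.single_eq_of_ne (add_one_ne_self i) _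
  have h2 : (Pi.single i s : Fin 3 → SignType) (i + 2) = 0 :=
    Pi.single_eq_of_ne (add_two_ne_self i) _
  have hz : ContinuousOn (fun x => ζ x i * affineFun a k x) B :=
    ContinuousOn.mul (by fun_prop) hf.continuousOn
  have hD : ∀ j, ContinuousOn
      (fun x => fderiv ℝ (fun x => entry S j i x * affineFun a k x) x (basisVec j)) B := fun j =>
    continuousOn_fderiv_apply hB (hU j) _
  have hC : ∀ j, ContinuousOn (fun x => a j * entry S j i x) B := fun j =>
    continuousOn_const.mul (contDiffOn_entry hS j i).continuousOn
  have hzD := hz.fun_sub (hD (i + 1))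
  have hzDD := hzD.fun_sub (hD (i + 2))
  -- The differences of edge integrals are folded back into face integrals of tangential derivatives
  -- of `S_ji f`; what remains is the product rule at each point.
  rw [← cellIntegral_fderiv_of_contDiffOn hB hδ hc h1 (hU (i + 1)),
    ← cellIntegral_fderiv_of_contDiffOn hB hδ hc h2 (hU (i + 2)),
    ← cellIntegral_sub hδ _ (hz.mono hc) ((hD _).mono hc),
    ← cellIntegral_sub hδ _ (hzD.mono hc) ((hD _).mono hc),
    ← cellIntegral_add hδ _ (hzDD.mono hc) (((hC _).fun_add (hC _)).mono hc),
    ← cellIntegral_const_mul]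
  refine cellIntegral_congr hδ _ fun x hx => ?_
  have hSx := (hS.differentiableOn one_ne_zero).differentiableAt (hB.mem_nhds (hc hx))
  have hCx : ∀ j, DifferentiableAt ℝ (entry S j i) x := fun j =>
    ((contDiffOn_entry hS j i).differentiableOn one_ne_zero).differentiableAt (hB.mem_nhds (hc hx))
  simp only [fderiv_mul_affineFun (hCx _), fderiv_entry_apply hSx, faceTraction_single ζ S i hs]
  ring

theorem cellIntegral_edgeTraction_mul {c : E3} {δ : ℝ} (hδ : 0 < δ)
    (hc : closedCube c δ ⊆ B) {S : E3 → Tensor} (hS : ContDiffOn ℝ 1 S B) (a : E3) (r : ℝ)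
    (k : Fin 3) {s s' : SignType} (hs : s ≠ 0) (hs' : s' ≠ 0) :
    cellIntegral c δ (edgeIndex k s s')
        (fun x => edgeTraction S (edgeIndex k s s') x * affineFun a r x) =
      s * s' * (cellIntegral c δ (edgeIndex k s s')
          (fun x => entry S (k + 2) (k + 1) x * affineFun a r x) +
        cellIntegral c δ (edgeIndex k s s')
          (fun x => entry S (k + 1) (k + 2) x * affineFun a r x)) := by
  have hU : ∀ j i, ContinuousOn (fun x => entry S j i x * affineFun a r x) B := fun j i =>
    (contDiffOn_entry hS j i).continuousOn.mul (contDiff_affineFun a r).continuous.continuousOn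
  rw [← cellIntegral_add hδ _ ((hU _ _).mono hc) ((hU _ _).mono hc), ← cellIntegral_const_mul]
  refine cellIntegral_congr hδ _ fun x _ => ?_
  simp only [edgeTraction_edgeIndex S k hs hs']
  ring

/-- The divergence theorem on the cube. -/
theorem cellIntegral_divergence (hB : IsOpen B) {c : E3} {δ : ℝ} (hδ : 0 < δ)
    (hc : closedCube c δ ⊆ B) {h : Fin 3 → E3 → ℝ} (hh : ∀ i, ContDiffOn ℝ 1 (h i) B) :
    cellIntegral c δ 0 (fun x => ∑ i, fderiv ℝ (h i) x (basisVec i)) =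
      ∑ i, (cellIntegral c δ (Pi.single i 1) (h i) -
        cellIntegral c δ (Pi.single i (-1)) (h i)) := by
  rw [cellIntegral_sum _ hδ _ fun i _ => (continuousOn_fderiv_apply hB (hh i) _).mono hc]
  exact Finset.sum_congr rfl fun i _ =>
    cellIntegral_fderiv_of_contDiffOn hB hδ hc (j := i) rfl (hh i)

/-- The power expended by the surface and edge microtractions of the cube over an affine field. -/
theorem traction_power (hB : IsOpen B) {c : E3} {δ : ℝ} (hδ : 0 < δ)
    (hc : closedCube c δ ⊆ B) {ζ : E3 → E3} {S : E3 → Tensor}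
    (hζ : ContDiffOn ℝ 1 ζ B) (hS : ContDiffOn ℝ 1 S B) (a : E3) (r : ℝ) :
    ∑ σ ∈ cellIndices 1, cellIntegral c δ σ (fun x => faceTraction ζ S σ x * affineFun a r x) +
      ∑ σ ∈ cellIndices 2, cellIntegral c δ σ (fun x => edgeTraction S σ x * affineFun a r x) =
    cellIntegral c δ 0 (fun x => vecDiv ζ x * affineFun a r x + ⟪a, ζ x⟫_ℝ) +
      ∑ i, (cellIntegral c δ (Pi.single i 1)
          (fun x => a (i + 1) * entry S (i + 1) i x + a (i + 2) * entry S (i + 2) i x) -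
        cellIntegral c δ (Pi.single i (-1))
          (fun x => a (i + 1) * entry S (i + 1) i x + a (i + 2) * entry S (i + 2) i x)) := by
  have hζi : ∀ i, ContDiffOn ℝ 1 (fun x => ζ x i) B := fun i => by
    simpa only [inner_basisVec] using (contDiffOn_const (c := basisVec i)).inner ℝ hζ
  have hdiv : cellIntegral c δ 0 (fun x => vecDiv ζ x * affineFun a r x + ⟪a, ζ x⟫_ℝ) =
      ∑ i, (cellIntegral c δ (Pi.single i 1) (fun x => ζ x i * affineFun a r x) -
        cellIntegral c δ (Pi.single i (-1)) (fun x => ζ x i * affineFun a r x)) := by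
    rw [← cellIntegral_divergence hB hδ hc
      fun i => (hζi i).mul (contDiff_affineFun a r).contDiffOn]
    refine cellIntegral_congr hδ _ fun x hx => ?_
    have hx' := hB.mem_nhds (hc hx)
    have hζx := (hζ.differentiableOn one_ne_zero).differentiableAt hx'
    have hd : ∀ i, DifferentiableAt ℝ (fun x => ζ x i) x := fun i =>
      ((hζi i).differentiableOn one_ne_zero).differentiableAt hx'
    have hfd : ∀ i, fderiv ℝ (fun x => ζ x i) x (basisVec i) =
        ⟪basisVec i, fderiv ℝ ζ x (basisVec i)⟫_ℝ := fun i => by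
      have h := (innerSL ℝ (basisVec i)).hasFDerivAt.comp x hζx.hasFDerivAt
      have h' : fderiv ℝ (fun x => ζ x i) x = _ :=
        (h.congr_of_eventuallyEq
          (Eventually.of_forall fun y => (inner_basisVec i (ζ y)).symm)).fderiv
      rw [h']
      simp
    simp only [fderiv_mul_affineFun (hd _), hfd, vecDiv, tensorTrace, Finset.sum_mul,
      Finset.sum_add_distrib]
    congr 1
    rw [PiLp.inner_apply]
    exact Finset.sum_congr rfl fun i _ => mul_comm _ _
  have h1 : (1 : SignType) ≠ 0 := by decide
  have hm : (-1 : SignType) ≠ 0 := by decide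
  rw [hdiv, sum_cellIndices_one, sum_cellIndices_two]
  simp only [cellIntegral_faceTraction_mul hB hδ hc hζ.continuousOn hS a r _ h1,
    cellIntegral_faceTraction_mul hB hδ hc hζ.continuousOn hS a r _ hm,
    cellIntegral_edgeTraction_mul hδ hc hS a r _ h1 h1,
    cellIntegral_edgeTraction_mul hδ hc hS a r _ h1 hm,
    cellIntegral_edgeTraction_mul hδ hc hS a r _ hm h1,
    cellIntegral_edgeTraction_mul hδ hc hS a r _ hm hm]
  -- `G i j` is the alternating sum of the integrals of `S_ji f` over the four edges where faces
  -- with normals `±e_i` and `±e_j` meet. The faces contribute it with a minus sign.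
  set G : Fin 3 → Fin 3 → ℝ := fun i j =>
    (cellIntegral c δ (Function.update (Pi.single i 1) j 1)
        (fun x => entry S j i x * affineFun a r x) -
      cellIntegral c δ (Function.update (Pi.single i 1) j (-1))
        (fun x => entry S j i x * affineFun a r x)) -
    (cellIntegral c δ (Function.update (Pi.single i (-1)) j 1)
        (fun x => entry S j i x * affineFun a r x) -
      cellIntegral c δ (Function.update (Pi.single i (-1)) j (-1))
        (fun x => entry S j i x * affineFun a r x)) with hGdef
  -- Cyclic shifts of the index group these sums by the direction `k` of the edge, as in the sum
  -- over edges.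
  have hG1 : ∑ i, G i (i + 1) = ∑ k, G (k + 1) (k + 2) := by
    rw [← sum_add_one fun i => G i (i + 1)]
    refine Finset.sum_congr rfl fun k _ => ?_
    rw [show k + 1 + 1 = k + 2 by decide +revert]
  have hG2 : ∑ i, G i (i + 2) = ∑ k, G (k + 2) (k + 1) := by
    rw [← sum_add_two fun i => G i (i + 2)]
    refine Finset.sum_congr rfl fun k _ => ?_
    rw [show k + 2 + 2 = k + 1 by decide +revert]
  have hsum := congrArg₂ (· + ·) hG1 hG2
  simp only [← Finset.sum_add_distrib, hGdef, update_single_add_one] at hsum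
  change _ = ∑ k, ((cellIntegral c δ (edgeIndex k 1 1) _ - cellIntegral c δ (edgeIndex k 1 (-1)) _ -
    (cellIntegral c δ (edgeIndex k (-1) 1) _ - cellIntegral c δ (edgeIndex k (-1) (-1)) _)) + _)
    at hsum
  simp only [SignType.coe_one, SignType.coe_neg_one]
  rw [← sub_eq_zero] at hsum ⊢
  rw [← neg_eq_zero, ← hsum, ← Finset.sum_add_distrib, ← Finset.sum_add_distrib,
    ← Finset.sum_sub_distrib, ← Finset.sum_sub_distrib, ← Finset.sum_neg_distrib]
  refine Finset.sum_congr rfl fun k _ => ?_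
  ring

end

/-! ### The two field equations. -/

section
variable {B : Set E3}

theorem continuousOn_vecDiv (hB : IsOpen B) {ζ : E3 → E3} (hζ : ContDiffOn ℝ 1 ζ B) :
    ContinuousOn (vecDiv ζ) B := by
  unfold vecDiv tensorTrace
  exact continuousOn_finsetSum _ fun _ _ => continuousOn_const.inner
    ((hζ.continuousOn_fderiv_of_isOpen hB le_rfl).clm_apply continuousOn_const)

theorem continuousOn_tensorDiv (hB : IsOpen B) {S : E3 → Tensor} (hS : ContDiffOn ℝ 1 S B) :
    ContinuousOn (tensorDiv S) B :=
  continuousOn_finsetSum _ fun _ _ =>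
    ((hS.continuousOn_fderiv_of_isOpen hB le_rfl).clm_apply continuousOn_const).clm_apply
      continuousOn_const

theorem vecDiv_add_eq_zero (hB : IsOpen B) {ζ : E3 → E3} {S : E3 → Tensor} {π γ : E3 → ℝ}
    (hζ : ContDiffOn ℝ 1 ζ B) (hS : ContDiffOn ℝ 1 S B) (hπ : ContinuousOn π B)
    (hγ : ContinuousOn γ B) (h : ∀ P : Part B, MicroforceBalance P ζ S π γ) {x : E3} (hx : x ∈ B) :
    vecDiv ζ x + π x + γ x = 0 := by
  have hd := continuousOn_vecDiv hB hζ
  have h0 : ∀ δ σ, cellIntegral x δ σ (fun _ => (0 : ℝ)) = 0 := fun δ σ => by simp [cellIntegral]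
  refine eq_zero_of_cellIntegral_eq_zero (q := fun x => vecDiv ζ x + π x + γ x) hB
    ((hd.add hπ).add hγ) hx fun δ hδ hc => ?_
  have hbal := cellIntegral_force_balance hB hδ hc hζ.continuousOn hS (h (cubePart x hδ hc))
  -- The affine function is the constant `1`, so all terms containing its gradient vanish.
  have hpow := traction_power hB hδ hc hζ hS 0 1
  simp only [affineFun, inner_zero_left, zero_add, mul_one, add_zero, PiLp.zero_apply, zero_mul,
    h0, sub_self, Finset.sum_const_zero] at hpow
  rw [add_assoc] at hbal
  have hsum := cellIntegral_add hδ 0 ((hπ.fun_add hγ).mono hc) (hd.mono hc)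
  rw [cellIntegral_congr (h := fun x => (π x + γ x) + vecDiv ζ x) hδ 0 fun y _ => by ring, hsum]
  rw [← hbal]
  congr 1
  exact hpow.symm

/-- This is where the form assumed for `ϖ_S` matters: the tangential part of `S n` left by the
integration by parts and the normal part `(n ⊗ n) S n` add up to all of `S n`. -/
theorem surfaceCouple_component {S : E3 → Tensor} (m i : Fin 3) {s : SignType} (hs : s ≠ 0)
    (x : E3) :
    (s : ℝ) * (basisVec m (i + 1) * entry S (i + 1) i x +
        basisVec m (i + 2) * entry S (i + 2) i x) +
      ⟪basisVec m, ⟪cellNormal (Pi.single i s), S x (cellNormal (Pi.single i s))⟫_ℝ •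
        cellNormal (Pi.single i s)⟫_ℝ = s * entry S m i x := by
  have hss : (s : ℝ) * s = 1 := signType_cast_mul_self hs
  rw [cellNormal_single]
  simp only [map_smul, real_inner_smul_left, real_inner_smul_right, inner_basisVec (m)]
  change _ + (s : ℝ) * (s * entry S i i x) * (s * basisVec i m) = _
  have h : (s : ℝ) * (s * entry S i i x) * (s * basisVec i m) =
      s * (entry S i i x * basisVec i m) := by
    linear_combination (s * entry S i i x * basisVec i m) * hss
  rw [h, ← mul_add]
  congr 1
  fin_cases i <;> fin_cases m <;> simp [basisVec_apply]

theorem microstress_eq (hB : IsOpen B) {o : E3} {ζ ξ : E3 → E3} {S : E3 → Tensor} {π γ : E3 → ℝ}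
    (hζ : ContDiffOn ℝ 1 ζ B) (hS : ContDiffOn ℝ 1 S B) (hξ : ContinuousOn ξ B)
    (hπ : ContinuousOn π B) (hγ : ContinuousOn γ B)
    (hfield : ∀ x ∈ B, vecDiv ζ x + π x + γ x = 0)
    (h : ∀ P : Part B, MicrotorqueBalance P o ζ ξ S π γ) {x : E3} (hx : x ∈ B) :
    ζ x = ξ x - tensorDiv S x := by
  have hd := continuousOn_vecDiv hB hζ
  have hT := continuousOn_tensorDiv hB hS
  have hr : ContinuousOn (fun x : E3 => x - o) B := by fun_prop
  suffices hm : ∀ m, ⟪basisVec m, ζ x - ξ x + tensorDiv S x⟫_ℝ = 0 by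
    have h0 : ζ x - ξ x + tensorDiv S x = 0 := by
      ext m
      rw [← inner_basisVec, hm m]
      rfl
    rw [← sub_eq_zero, ← h0]
    abel
  intro m
  refine eq_zero_of_cellIntegral_eq_zero
    (q := fun x => ⟪basisVec m, ζ x - ξ x + tensorDiv S x⟫_ℝ) hB
    (continuousOn_const.inner ((hζ.continuousOn.sub hξ).add hT)) hx fun δ hδ hc => ?_
  have hbal := cellIntegral_torque_balance hB hδ hc hζ.continuousOn hS (h (cubePart x hδ hc))
  -- The affine function is the moment arm `(x - o)_m`.
  have hpow := traction_power hB hδ hc hζ hS (basisVec m) (-o m)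
  have haff : ∀ y, ⟪basisVec m, y - o⟫_ℝ = affineFun (basisVec m) (-o m) y := fun y => by
    rw [affineFun, inner_sub_right, inner_basisVec m o, sub_eq_add_neg]
  have hF := fun σ => continuousOn_faceTraction hB hζ.continuousOn hS σ
  have hE := fun σ => continuousOn_edgeTraction hS.continuousOn σ
  have hN : ∀ σ, ContinuousOn (fun x => ⟪cellNormal σ, S x (cellNormal σ)⟫_ℝ • cellNormal σ) B :=
    fun σ => by
      have h₁ : ContinuousOn (fun x => ⟪cellNormal σ, S x (cellNormal σ)⟫_ℝ) B :=
        continuousOn_const.inner (hS.continuousOn.clm_apply continuousOn_const)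
      exact h₁.smul continuousOn_const
  have hA := (contDiff_affineFun (basisVec m) (-o m)).continuous.continuousOn (s := B)
  have hV : ContinuousOn (fun x => (π x + γ x) • (x - o) - ξ x) B := ((hπ.add hγ).smul hr).sub hξ
  have hcomp := congrArg (fun v => ⟪basisVec m, v⟫_ℝ) hbal
  simp only [inner_add_right, inner_sum, inner_zero_right] at hcomp
  rw [inner_cellIntegral hδ 0 _ (hV.mono hc)] at hcomp
  have hface : ∀ σ, ⟪basisVec m, cellIntegral x δ σ (fun x => faceTraction ζ S σ x • (x - o) +
        ⟪cellNormal σ, S x (cellNormal σ)⟫_ℝ • cellNormal σ)⟫_ℝ =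
      cellIntegral x δ σ (fun x => faceTraction ζ S σ x * affineFun (basisVec m) (-o m) x) +
      cellIntegral x δ σ (fun x =>
        ⟪basisVec m, ⟪cellNormal σ, S x (cellNormal σ)⟫_ℝ • cellNormal σ⟫_ℝ) := fun σ => by
    rw [inner_cellIntegral hδ σ _ ((((hF σ).fun_smul hr).fun_add (hN σ)).mono hc),
      ← cellIntegral_add hδ σ (((hF σ).fun_mul hA).mono hc)
        ((continuousOn_const.inner (hN σ)).mono hc)]
    refine cellIntegral_congr hδ σ fun y _ => ?_
    simp only [inner_add_right, real_inner_smul_right _ (y - o), haff]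
  have hedge : ∀ σ, ⟪basisVec m, cellIntegral x δ σ (fun x => edgeTraction S σ x • (x - o))⟫_ℝ =
      cellIntegral x δ σ (fun x => edgeTraction S σ x * affineFun (basisVec m) (-o m) x) :=
    fun σ => by
      rw [inner_cellIntegral hδ σ _ (((hE σ).fun_smul hr).mono hc)]
      refine cellIntegral_congr hδ σ fun y _ => ?_
      simp only [real_inner_smul_right, haff]
  simp only [hface, hedge, Finset.sum_add_distrib] at hcomp
  -- Leftover of the power identity plus couple microtraction is the flux of the `m`-th row of `S`,
  -- to which the divergence theorem applies.
  have hcouple : ∑ i, (cellIntegral x δ (Pi.single i 1) (fun x =>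
          basisVec m (i + 1) * entry S (i + 1) i x + basisVec m (i + 2) * entry S (i + 2) i x) -
        cellIntegral x δ (Pi.single i (-1)) (fun x =>
          basisVec m (i + 1) * entry S (i + 1) i x + basisVec m (i + 2) * entry S (i + 2) i x)) +
      ∑ σ ∈ cellIndices 1, cellIntegral x δ σ (fun x =>
        ⟪basisVec m, ⟪cellNormal σ, S x (cellNormal σ)⟫_ℝ • cellNormal σ⟫_ℝ) =
      cellIntegral x δ 0 (fun x => ⟪basisVec m, tensorDiv S x⟫_ℝ) := by
    have hdiv := cellIntegral_divergence hB hδ hc fun i => contDiffOn_entry hS m i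
    rw [cellIntegral_congr (h := fun x => ⟪basisVec m, tensorDiv S x⟫_ℝ) hδ 0 fun y hy => ?_]
      at hdiv
    · rw [hdiv, sum_cellIndices_one, ← Finset.sum_add_distrib]
      refine Finset.sum_congr rfl fun i _ => ?_
      have hcont : ContinuousOn (fun x =>
          basisVec m (i + 1) * entry S (i + 1) i x + basisVec m (i + 2) * entry S (i + 2) i x) B :=
        (continuousOn_const.mul (contDiffOn_entry hS _ _).continuousOn).add
          (continuousOn_const.mul (contDiffOn_entry hS _ _).continuousOn)
      have key : ∀ s : SignType, s ≠ 0 → (s : ℝ) * cellIntegral x δ (Pi.single i s) (fun x =>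
          basisVec m (i + 1) * entry S (i + 1) i x + basisVec m (i + 2) * entry S (i + 2) i x) +
          cellIntegral x δ (Pi.single i s) (fun x =>
            ⟪basisVec m, ⟪cellNormal (Pi.single i s), S x (cellNormal (Pi.single i s))⟫_ℝ •
              cellNormal (Pi.single i s)⟫_ℝ) =
          s * cellIntegral x δ (Pi.single i s) (entry S m i) := fun s hs => by
        rw [← cellIntegral_const_mul, ← cellIntegral_const_mul,
          ← cellIntegral_add hδ _ ((continuousOn_const.fun_mul hcont).mono hc)
            (ContinuousOn.mono (continuousOn_const.inner (hN (Pi.single i s))) hc)]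
        exact cellIntegral_congr hδ _ fun y _ => surfaceCouple_component m i hs y
      have k1 := key 1 (by decide)
      have k2 := key (-1) (by decide)
      simp only [SignType.coe_one, SignType.coe_neg_one] at k1 k2
      linarith
    · have hSy := (hS.differentiableOn one_ne_zero).differentiableAt (hB.mem_nhds (hc hy))
      simp only [fderiv_entry_apply hSy, tensorDiv, inner_sum]
  have hW : ContinuousOn (fun x => vecDiv ζ x * affineFun (basisVec m) (-o m) x +
      ⟪basisVec m, ζ x⟫_ℝ) B := (hd.mul hA).add (continuousOn_const.inner hζ.continuousOn)
  have hV' : ContinuousOn (fun x => ⟪basisVec m, (π x + γ x) • (x - o) - ξ x⟫_ℝ) B :=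
    continuousOn_const.inner hV
  have hT' : ContinuousOn (fun x => ⟪basisVec m, tensorDiv S x⟫_ℝ) B := continuousOn_const.inner hT
  have htotal := cellIntegral_add hδ 0 ((hV'.fun_add hW).mono hc) (hT'.mono hc)
  rw [cellIntegral_add hδ 0 (hV'.mono hc) (hW.mono hc)] at htotal
  rw [cellIntegral_congr (h := fun x => ⟪basisVec m, (π x + γ x) • (x - o) - ξ x⟫_ℝ +
      (vecDiv ζ x * affineFun (basisVec m) (-o m) x + ⟪basisVec m, ζ x⟫_ℝ) +
      ⟪basisVec m, tensorDiv S x⟫_ℝ) hδ 0 fun y hy => ?_, htotal]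
  · linarith
  · simp only [inner_add_right, inner_sub_right _ (_ • _), inner_sub_right _ (ζ y),
      real_inner_smul_right, haff]
    -- The terms with the moment arm are `(div ζ + π + γ) (y - o)_m`, which vanish by the first
    -- field equation.
    linear_combination (-affineFun (basisVec m) (-o m) y) * hfield y (hc hy)

end

end PhaseField

end

theorem mainTheorem5 (B : Set PhaseField.E3) (hB : IsOpen B) (T : Set ℝ) (o : PhaseField.E3)
    (ζ ξ : PhaseField.E3 → ℝ → PhaseField.E3) (S : PhaseField.E3 → ℝ → PhaseField.Tensor)
    (π γ : PhaseField.E3 → ℝ → ℝ)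
    (hζ : ∀ t ∈ T, ContDiffOn ℝ 1 (fun x => ζ x t) B)
    (hS : ∀ t ∈ T, ContDiffOn ℝ 1 (fun x => S x t) B)
    (hξ : ∀ t ∈ T, ContinuousOn (fun x => ξ x t) B)
    (hπ : ∀ t ∈ T, ContinuousOn (fun x => π x t) B)
    (hγ : ∀ t ∈ T, ContinuousOn (fun x => γ x t) B)
    (hforce : ∀ t ∈ T, ∀ P : PhaseField.Part B,
      PhaseField.MicroforceBalance P (fun x => ζ x t) (fun x => S x t)
        (fun x => π x t) (fun x => γ x t)) :
    (∀ t ∈ T, ∀ x ∈ B, PhaseField.vecDiv (fun y => ζ y t) x + π x t + γ x t = 0) ∧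
    ((∀ t ∈ T, ∀ P : PhaseField.Part B,
        PhaseField.MicrotorqueBalance P o (fun x => ζ x t) (fun x => ξ x t) (fun x => S x t)
          (fun x => π x t) (fun x => γ x t)) →
      (∀ t ∈ T, ∀ x ∈ B, ζ x t = ξ x t - PhaseField.tensorDiv (fun y => S y t) x) ∧
      (∀ t ∈ T, ∀ x ∈ B,
        DifferentiableAt ℝ (fun y => ξ y t - PhaseField.tensorDiv (fun z => S z t) y) x ∧
        PhaseField.vecDiv (fun y => ξ y t - PhaseField.tensorDiv (fun z => S z t) y) x
          + π x t + γ x t = 0)) := by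

  have hfield : ∀ t ∈ T, ∀ x ∈ B, PhaseField.vecDiv (fun y => ζ y t) x + π x t + γ x t = 0 :=
    fun t ht x hx => PhaseField.vecDiv_add_eq_zero hB (hζ t ht) (hS t ht) (hπ t ht) (hγ t ht)
      (hforce t ht) hx
  refine ⟨hfield, fun htorque => ?_⟩
  have hstress : ∀ t ∈ T, ∀ x ∈ B,
      ζ x t = ξ x t - PhaseField.tensorDiv (fun y => S y t) x := fun t ht x hx =>
    PhaseField.microstress_eq hB (hζ t ht) (hS t ht) (hξ t ht) (hπ t ht) (hγ t ht)
      (hfield t ht) (htorque t ht) hx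
  refine ⟨hstress, fun t ht x hx => ?_⟩
  -- `ξ` and `div S` are each only known to be continuous; their difference is differentiable
  -- because it agrees with `ζ` near `x`.
  have heq : (fun y => ξ y t - PhaseField.tensorDiv (fun z => S z t) y) =ᶠ[𝓝 x]
      fun y => ζ y t := by
    filter_upwards [hB.mem_nhds hx] with y hy using (hstress t ht y hy).symm
  have hd : DifferentiableAt ℝ (fun y => ζ y t) x :=
    ((hζ t ht).differentiableOn one_ne_zero).differentiableAt (hB.mem_nhds hx)
  refine ⟨hd.congr_of_eventuallyEq heq, ?_⟩
  have := hfield t ht x hx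
  rwa [PhaseField.vecDiv, ← heq.fderiv_eq] at this
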